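/- **Setting.** Let $n\in\{1,2\}$, $T>0$, and let $\Omega\subset\mathbb R^{n+1}$ be a bounded polyhedral domain. Let $\phi:\Omega\times[0,T]\to\mathbb R$ be smooth, $\Gamma(t)=\{x\in\Omega:\phi(x,t)=0\}$ and $U_r(t)=\{x\in\Omega:|\phi(x,t)|<r\}$. Assume that every $\Gamma(t)$ is (nonempty and) connected, and that there are $\delta_0>0$, $0<c_0\le c_1$, $c_2>0$ such that for all $t\in[0,T]$ one has $\overline{U_{\delta_0}(t)}\subset\Omega$ and, on $U_{\delta_0}(t)$, $c_0\le|\nabla\phi|\le c_1$ and $|D^2\phi|,|\phi_t|,|\phi_{tt}|\le c_2$. Let $\Phi:\Gamma(0)\times[0,T]\to\mathbb R^{n+1}$ be smooth, with $\Phi(\cdot,t)$ a diffeomorphism of $\Gamma(0)$ onto $\Gamma(t)$ for each $t\in[0,T]$, $\Phi(P,0)=P$ and $\partial_t\Phi(P,t)=\mathbf v(\Phi(P,t),t)$ for $t\in(0,T]$, where $\mathbf v$ is the given velocity field on the surfaces. Fix $0<\delta<\delta_0$. For $x\in U_\delta(t)$ let $\tilde p(x,t)=\Phi(P,t)$, where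 $P\in\Gamma(0)$ is the point for which the solution of $\gamma'(s)=\nabla\phi(\gamma(s),t)/|\nabla\phi(\gamma(s),t)|^2$, $|s|<\delta$, $\gamma(0)=\Phi(P,t)$, satisfies $\gamma(\phi(x,t))=x$. Put $z^e(x,t)=z(\tilde p(x,t),t)$ on $U_\delta(t)$, and $z^e=0$ outside $U_\delta(t)$. With $\nu=\nabla\phi/|\nabla\phi|$, $V=-\phi_t/|\nabla\phi|$ and $\mathbf v_\tau=(I-\nu\otimes\nu)\mathbf v$ on $\Gamma(t)$, extend $\mathbf v$ to $U_\delta(t)$ by $V\nu+(I-\nu\otimes\nu)\mathbf v_\tau^e$. Let $g(r)=\cos^2 r$ for $|r|\le\pi/2$ and $g(r)=0$ otherwise; for $0<\epsilon<\delta/\pi$ let $\rho=g(\phi/\epsilon)$ and $\tilde\rho=g(\phi/(2\epsilon))$ on $\Omega$, and $0$ outside $\Omega$. Let $\mathcal T_h$ be a conforming triangulation of $\overline\Omega$ into closed simplices with vertex set $\mathcal N_h$ and mesh size $h=\max_{K\in\mathcal T_h}h_K$, $h_K=\operatorname{diam}K$; it is called $\sigma$-regular if every $K\in\mathcal T_h$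 has inradius at least $\sigma h_K$. For a partition $0=t_0<\dots<t_M=T$ let $\tau_m=t_m-t_{m-1}$, $\tau=\max_m\tau_m$, and write $w^m=w(\cdot,t_m)$. Let $\mathcal T_h^m$ be the set of simplices with a vertex at which $\tilde\rho^m>0$, let $D_h^m$ be their union, and let $V_h^m$ be the space of continuous functions on $D_h^m$ that are affine on each simplex of $\mathcal T_h^m$; elements of $V_h^m$ are extended by $0$ outside $D_h^m$. Let $I_h^m$ be the Lagrange interpolation operator into $V_h^m$. Let $\gamma>0$. The scheme reads: for $m=1,\dots,M$ find $u_h^m\in V_h^m$ such that for all $v_h\in V_h^m$ $$\int_\Omega u_h^mv_h\rho^m|\nabla\phi^m|-\int_\Omega u_h^{m-1}v_h\rho^{m-1}|\nabla\phi^{m-1}|+\tau_m\int_\Omega(\nabla u_h^m,\nabla v_h)\rho^m|\nabla\phi^m|$$ $$-\tau_m\int_\Omega u_h^m(\mathbf v^m,\nabla v_h)\rho^m|\nabla\phi^m|+\gamma\tau_m^2\int_\Omega I_h^m\tilde\rho^m(\nabla u_h^m,\nabla v_h)=\tau_m\int_\Omega f^{e,m}v_h\rho^m|\nabla\phi^m|,\qquad(\ast)$$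 where $u_h^0\in V_h^0$ is the $L^2(D_h^0)$-projection of $u_0^e(x)=u_0(\tilde p(x,0))$, i.e. $\int_{D_h^0}u_h^0v_h=\int_{D_h^0}u_0^ev_h$ for all $v_h\in V_h^0$. The data $u_0$, $f$ are such that $u_0^e$ is integrable over $U_\delta(0)$ and $f^{e,m}$ is integrable over $U_\delta(t_m)$ for $m=1,\dots,M$. **Lemma 5 (existence).** Let $h_0>0$ and $\sigma>0$. There is $h_1\in(0,h_0]$ such that for every $0<h\le h_1$ there is $\tau_0>0$ with the following property: for every $\sigma$-regular triangulation $\mathcal T_h$ of mesh size $h$, every $0<\epsilon<\delta/\pi$, every $\gamma>0$, every partition of $[0,T]$ with $\tau\le\tau_0$ and all data $f$, $u_0$ as above, for each $m=1,\dots,M$ and each given $u_h^{m-1}\in V_h^{m-1}$ the equation $(\ast)$ has a unique solution $u_h^m\in V_h^m$; consequently the whole scheme, with the initial condition above, has a unique solution $(u_h^0,\dots,u_h^M)$. -/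

import Mathlib

open MeasureTheory Set
open scoped ContDiff

/-- The ambient Euclidean space `ℝ^(n+1)`. -/
abbrev Amb (n : ℕ) := EuclideanSpace ℝ (Fin (n + 1))

/-- The zero level set `Γ(t)` in `Ω` of a time dependent function `φ`. -/
def zeroSet {n : ℕ} (Ω : Set (Amb n)) (φ : Amb n → ℝ → ℝ) (t : ℝ) : Set (Amb n) :=
  {x | x ∈ Ω ∧ φ x t = 0}

/-- The band `U_r(t) = {x ∈ Ω : |φ(x,t)| < r}`. -/
def levelBand {n : ℕ} (Ω : Set (Amb n)) (φ : Amb n → ℝ → ℝ) (r t : ℝ) : Set (Amb n) :=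
  {x | x ∈ Ω ∧ |φ x t| < r}

/-- The spatial gradient `∇φ(x,t)`. -/
noncomputable def gradAt {n : ℕ} (φ : Amb n → ℝ → ℝ) (x : Amb n) (t : ℝ) : Amb n :=
  gradient (fun y => φ y t) x

/-- A moving surface `Γ(t)`, `0 ≤ t ≤ T`, given as the zero level set of a smooth function on
`Ω × [0,T]` (with nondegenerate gradient near `Γ(t)`), transported by a smooth family of
diffeomorphisms `Φ(·,t) : Γ(0) → Γ(t)` with velocity `vel`. -/
structure MovingSurface (n : ℕ) where
  /-- the bulk domain -/
  Ω : Set (Amb n)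
  /-- the final time -/
  T : ℝ
  /-- the level set function -/
  φ : Amb n → ℝ → ℝ
  /-- the flow map -/
  Φ : Amb n → ℝ → Amb n
  /-- the velocity field, prescribed on `Γ(t)` -/
  vel : Amb n → ℝ → Amb n
  /-- half-width, in level set values, of the band on which the derivative bounds hold -/
  δ₀ : ℝ
  c₀ : ℝ
  c₁ : ℝ
  c₂ : ℝ
  T_pos : 0 < T
  isOpen_Ω : IsOpen Ω
  isConnected_Ω : IsConnected Ω
  isBounded_Ω : Bornology.IsBounded Ω
  smooth_φ : ContDiffOn ℝ ∞ (fun q : Amb n × ℝ => φ q.1 q.2) (Ω ×ˢ Icc 0 T)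
  isConnected_Γ : ∀ t ∈ Icc 0 T, IsConnected (zeroSet Ω φ t)
  δ₀_pos : 0 < δ₀
  c₀_pos : 0 < c₀
  c₀_le : c₀ ≤ c₁
  c₂_pos : 0 < c₂
  closure_band : ∀ t ∈ Icc 0 T, closure (levelBand Ω φ δ₀ t) ⊆ Ω
  grad_lower : ∀ t ∈ Icc 0 T, ∀ x ∈ levelBand Ω φ δ₀ t, c₀ ≤ ‖gradAt φ x t‖
  grad_upper : ∀ t ∈ Icc 0 T, ∀ x ∈ levelBand Ω φ δ₀ t, ‖gradAt φ x t‖ ≤ c₁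
  hess_upper : ∀ t ∈ Icc 0 T, ∀ x ∈ levelBand Ω φ δ₀ t,
    ‖fderiv ℝ (fun y => gradAt φ y t) x‖ ≤ c₂
  dt_upper : ∀ t ∈ Icc 0 T, ∀ x ∈ levelBand Ω φ δ₀ t,
    |derivWithin (fun s => φ x s) (Icc 0 T) t| ≤ c₂
  dtt_upper : ∀ t ∈ Icc 0 T, ∀ x ∈ levelBand Ω φ δ₀ t,
    |iteratedDerivWithin 2 (fun s => φ x s) (Icc 0 T) t| ≤ c₂
  smooth_Φ : ContDiffOn ℝ ∞ (fun q : Amb n × ℝ => Φ q.1 q.2) (zeroSet Ω φ 0 ×ˢ Icc 0 T)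
  bijOn_Φ : ∀ t ∈ Icc 0 T, BijOn (fun P => Φ P t) (zeroSet Ω φ 0) (zeroSet Ω φ t)
  smooth_Φ_inv : ∀ t ∈ Icc 0 T,
    ContDiffOn ℝ ∞ (Function.invFunOn (fun P => Φ P t) (zeroSet Ω φ 0)) (zeroSet Ω φ t)
  flow_init : ∀ P ∈ zeroSet Ω φ 0, Φ P 0 = P
  flow : ∀ t ∈ Ioc 0 T, ∀ P ∈ zeroSet Ω φ 0,
    HasDerivWithinAt (fun s => Φ P s) (vel (Φ P t) t) (Icc 0 T) t

namespace MovingSurface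

variable {n : ℕ} (S : MovingSurface n)

/-- The surface `Γ(t)`. -/
def surf (t : ℝ) : Set (Amb n) := zeroSet S.Ω S.φ t

/-- The band `U_r(t)`. -/
def band (r t : ℝ) : Set (Amb n) := levelBand S.Ω S.φ r t

/-- The unit normal `ν = ∇φ / |∇φ|`, defined near `Γ(t)`. -/
noncomputable def normal (x : Amb n) (t : ℝ) : Amb n :=
  ‖gradAt S.φ x t‖⁻¹ • gradAt S.φ x t

/-- The normal velocity `V = -φ_t / |∇φ|`, defined near `Γ(t)`. -/
noncomputable def normalVel (x : Amb n) (t : ℝ) : ℝ :=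
  -derivWithin (fun s => S.φ x s) (Icc 0 S.T) t / ‖gradAt S.φ x t‖

/-- The projection `(I - ν ⊗ ν) w` at the point `(x,t)`. -/
noncomputable def tangProj (x : Amb n) (t : ℝ) (w : Amb n) : Amb n :=
  w - inner ℝ (S.normal x t) w • S.normal x t

/-- `γ` solves `γ' = ∇φ(γ,t) / |∇φ(γ,t)|²` on `(-δ,δ)` with `γ(0) = y`. -/
def IsNormalCurve (δ t : ℝ) (y : Amb n) (γ : ℝ → Amb n) : Prop :=
  γ 0 = y ∧ ∀ s ∈ Ioo (-δ) δ, γ s ∈ S.Ω ∧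
    HasDerivAt γ ((‖gradAt S.φ (γ s) t‖ ^ 2)⁻¹ • gradAt S.φ (γ s) t) s

/-- The label `p(x,t) ∈ Γ(0)`: the point `P` such that the normal curve through `Φ(P,t)` passes
through `x` at parameter value `φ(x,t)`. -/
noncomputable def label (δ : ℝ) (x : Amb n) (t : ℝ) : Amb n :=
  Classical.epsilon fun P => P ∈ S.surf 0 ∧
    ∃ γ : ℝ → Amb n, S.IsNormalCurve δ t (S.Φ P t) γ ∧ γ (S.φ x t) = x

/-- The projection `p̃(x,t) = Φ(p(x,t),t)` of `U_δ(t)` onto `Γ(t)`. -/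
noncomputable def proj (δ : ℝ) (x : Amb n) (t : ℝ) : Amb n :=
  S.Φ (S.label δ x t) t

open Classical in
/-- The extension `z^e(x,t) = z(p̃(x,t),t)` of a scalar function from `Γ(t)` to `U_δ(t)`
(with value `0` outside of `U_δ(t)`). -/
noncomputable def ext (δ : ℝ) (z : Amb n → ℝ → ℝ) (x : Amb n) (t : ℝ) : ℝ :=
  if x ∈ S.band δ t then z (S.proj δ x t) t else 0

/-- The extended velocity `V ν + (I - ν ⊗ ν) v_τ^e` on `U_δ(t)`, where `v_τ` is the tangential part
of the prescribed velocity on `Γ(t)`. -/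
noncomputable def velExt (δ : ℝ) (x : Amb n) (t : ℝ) : Amb n :=
  S.normalVel x t • S.normal x t +
    S.tangProj x t (S.tangProj (S.proj δ x t) t (S.vel (S.proj δ x t) t))

end MovingSurface

/-- The profile `g(r) = cos² r` for `|r| ≤ π/2`, and `0` otherwise. -/
noncomputable def profile (r : ℝ) : ℝ :=
  if |r| ≤ Real.pi / 2 then Real.cos r ^ 2 else 0

/-- The phase field `g(φ(x,t)/ε)` on `Ω`, extended by `0`. With parameter `ε` this is `ρ`, with
parameter `2ε` it is `ρ̃`. -/
noncomputable def MovingSurface.phase {n : ℕ} (S : MovingSurface n) (ε : ℝ) (x : Amb n) (t : ℝ) :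
    ℝ :=
  S.Ω.indicator (fun y => profile (S.φ y t / ε)) x

/-! ### Triangulations -/

/-- The closed simplex spanned by a finite set of points. -/
def simplex {n : ℕ} (s : Finset (Amb n)) : Set (Amb n) := convexHull ℝ (s : Set (Amb n))

/-- The top-dimensional simplices of a simplicial complex, through their vertex sets. -/
def cells {n : ℕ} (K : Geometry.SimplicialComplex ℝ (Amb n)) : Set (Finset (Amb n)) :=
  {s | s ∈ K.faces ∧ s.card = n + 2}

/-- `K` is a (conforming) triangulation of the polyhedral domain `Ω`: a finite simplicial complex
filling the closure of `Ω`, each of whose faces is a face of an `(n+1)`-dimensional simplex. -/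
structure IsTriangulation {n : ℕ} (Ω : Set (Amb n)) (K : Geometry.SimplicialComplex ℝ (Amb n)) :
    Prop where
  finite : K.faces.Finite
  pure : ∀ s ∈ K.faces, ∃ t ∈ cells K, s ⊆ t
  space_eq : K.space = closure Ω

/-- The mesh size: the largest diameter of a simplex. -/
noncomputable def meshSize {n : ℕ} (K : Geometry.SimplicialComplex ℝ (Amb n)) : ℝ :=
  sSup ((fun s => Metric.diam (simplex s)) '' cells K)

/-- The radius of the largest ball contained in a set. -/
noncomputable def inradius {n : ℕ} (A : Set (Amb n)) : ℝ :=
  sSup {r | 0 ≤ r ∧ ∃ c, Metric.closedBall c r ⊆ A}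

/-- Shape regularity with constant `σ`. -/
def IsShapeRegular {n : ℕ} (σ : ℝ) (K : Geometry.SimplicialComplex ℝ (Amb n)) : Prop :=
  ∀ s ∈ cells K, σ * Metric.diam (simplex s) ≤ inradius (simplex s)

/-! ### Discrete spaces and the scheme -/

namespace MovingSurface

variable {n : ℕ} (S : MovingSurface n) (K : Geometry.SimplicialComplex ℝ (Amb n))

/-- The active simplices at time `t`: those with a vertex at which `ρ̃(·,t) > 0`. -/
def activeCells (ε t : ℝ) : Set (Finset (Amb n)) :=
  {s | s ∈ cells K ∧ ∃ x ∈ s, 0 < S.phase (2 * ε) x t}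

/-- The discrete band: the union of the active simplices. -/
def discreteBand (ε t : ℝ) : Set (Amb n) :=
  ⋃ s ∈ S.activeCells K ε t, simplex s

/-- The finite element space on the discrete band: continuous functions that are affine on each
active simplex. They are represented by their extension by `0` to the whole space. -/
def feSpace (ε t : ℝ) : Set (Amb n → ℝ) :=
  {v | ContinuousOn v (S.discreteBand K ε t) ∧
    (∀ s ∈ S.activeCells K ε t, ∃ A : Amb n →ᵃ[ℝ] ℝ, EqOn v A (simplex s)) ∧
    ∀ x ∉ S.discreteBand K ε t, v x = 0}

/-- The Lagrange interpolant of `f`: the element of the finite element space that agrees with `f`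
at the vertices in the discrete band. -/
noncomputable def interp (ε t : ℝ) (f : Amb n → ℝ) : Amb n → ℝ :=
  Classical.epsilon fun w => w ∈ S.feSpace K ε t ∧
    ∀ x ∈ S.discreteBand K ε t ∩ K.vertices, w x = f x

/-- The weight `ρ |∇φ|`. -/
noncomputable def weight (ε : ℝ) (x : Amb n) (t : ℝ) : ℝ :=
  S.phase ε x t * ‖gradAt S.φ x t‖

/-- One step, from time `t'` to time `t`, of the fully discrete scheme: `u` is related to the
previous function `w` by the variational equation, tested with all elements of the finite element
space at time `t`. -/
def StepEq (δ ε γ : ℝ) (f : Amb n → ℝ → ℝ) (t' t : ℝ) (w u : Amb n → ℝ) : Prop :=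
  ∀ v ∈ S.feSpace K ε t,
    (∫ x in S.Ω, u x * v x * S.weight ε x t)
      - (∫ x in S.Ω, w x * v x * S.weight ε x t')
      + (t - t') * (∫ x in S.Ω, inner ℝ (gradient u x) (gradient v x) * S.weight ε x t)
      - (t - t') * (∫ x in S.Ω, u x * inner ℝ (S.velExt δ x t) (gradient v x) * S.weight ε x t)
      + γ * (t - t') ^ 2 * (∫ x in S.Ω, S.interp K ε t (fun y => S.phase (2 * ε) y t) x *
          inner ℝ (gradient u x) (gradient v x))
    = (t - t') * (∫ x in S.Ω, S.ext δ f x t * v x * S.weight ε x t)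

/-- `u` is the `L²` projection onto the initial finite element space of the extension of `u₀`. -/
def InitEq (δ ε : ℝ) (u₀ : Amb n → ℝ) (u : Amb n → ℝ) : Prop :=
  ∀ v ∈ S.feSpace K ε 0,
    (∫ x in S.discreteBand K ε 0, u x * v x)
      = ∫ x in S.discreteBand K ε 0, S.ext δ (fun y _ => u₀ y) x 0 * v x

end MovingSurface

/-- A partition `0 = t_0 < t_1 < ... < t_M = T` of `[0,T]`. -/
structure TimePartition (T : ℝ) where
  M : ℕ
  t : Fin (M + 1) → ℝ
  strictMono : StrictMono t
  first : t 0 = 0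
  last : t (Fin.last M) = T

/-- The maximal time step `τ`. -/
noncomputable def TimePartition.maxStep {T : ℝ} (P : TimePartition T) : ℝ :=
  ⨆ m : Fin P.M, (P.t m.succ - P.t m.castSucc)

/-- A discrete solution: a sequence `u^0, …, u^M` of finite element functions with the prescribed
initial function, each of which solves the scheme for the preceding one. -/
def MovingSurface.IsDiscreteSolution {n : ℕ} (S : MovingSurface n)
    (K : Geometry.SimplicialComplex ℝ (Amb n)) (δ ε γ : ℝ) (P : TimePartition S.T)
    (u₀ : Amb n → ℝ) (f : Amb n → ℝ → ℝ) (u : Fin (P.M + 1) → Amb n → ℝ) : Prop :=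
  (∀ m, u m ∈ S.feSpace K ε (P.t m)) ∧
  S.InitEq K δ ε u₀ (u 0) ∧
  ∀ m : Fin P.M, S.StepEq K δ ε γ f (P.t m.castSucc) (P.t m.succ) (u m.castSucc) (u m.succ)

/-!
A step of the scheme is a square linear system on a finite-dimensional space, so it suffices that
its bilinear form is definite. By Young's inequality the advection term is absorbed by the mass and
stiffness terms as soon as `τ ‖v‖² < 4` on the band. If the form vanishes at `u`, then `u = 0`
almost everywhere on `ρ > 0`, and by the stabilization term `u` is constant on each active simplex.
On a fine shape-regular mesh every vertex of the band lies in a simplex that meets `Γ(t)` or has a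
vertex with smaller `|φ|`, because some edge of a fat simplex makes a controlled angle with `∓∇φ`
and the Taylor remainder along an edge is of second order. Hence `u` vanishes at all vertices of
the band: among those with `u ≠ 0`, one minimizing `|φ|` would lie in a simplex meeting `Γ(t)`,
which contains points with `ρ > 0`.

The integrals of the scheme are honest: the extended velocity is bounded because the given one is
the time derivative of `Φ` on the compact set `Γ(0) × [0, T]`, and it is measurable because, by
Grönwall's inequality, the projection onto `Γ(t)` along the normal flow is continuous at fixed `t`.
-/

open Filter Topology

section Calculus

lemma exists_first_exit {X : Type*} [TopologicalSpace X] {c : ℝ → X} (hc : Continuous c)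
    {U : Set X} (hU : IsOpen U) {a b : ℝ} (hab : a ≤ b) (ha : c a ∈ U) (hb : c b ∉ U) :
    ∃ s ∈ Ioc a b, c s ∉ U ∧ ∀ r ∈ Ico a s, c r ∈ U := by
  obtain ⟨s, ⟨hs, hsU⟩, hmin⟩ :=
    (isCompact_Icc.inter_right (hU.isClosed_compl.preimage hc)).exists_isLeast
      (⟨b, right_mem_Icc.2 hab, hb⟩ : (Icc a b ∩ c ⁻¹' Uᶜ).Nonempty)
  have has : a < s := hs.1.lt_of_ne (by rintro rfl; exact hsU ha)
  refine ⟨s, ⟨has, hs.2⟩, hsU, fun r hr => ?_⟩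
  by_contra hrU
  exact (hmin ⟨⟨hr.1, hr.2.le.trans hs.2⟩, hrU⟩).not_gt hr.2

lemma norm_image_sub_sub_fderiv_le_of_lipschitz {E F : Type*} [NormedAddCommGroup E]
    [NormedSpace ℝ E] [NormedAddCommGroup F] [NormedSpace ℝ F] {f : E → F} {f' : E → E →L[ℝ] F}
    {x z : E} {C : ℝ} (hf : ∀ y ∈ segment ℝ x z, HasFDerivAt f (f' y) y)
    (hC : 0 ≤ C) (hf' : ∀ y ∈ segment ℝ x z, ‖f' y - f' x‖ ≤ C * ‖y - x‖) :
    ‖f z - f x - f' x (z - x)‖ ≤ C * ‖z - x‖ ^ 2 := by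
  have hbound : ∀ y ∈ segment ℝ x z, ‖f' y - f' x‖ ≤ C * ‖z - x‖ := fun y hy =>
    (hf' y hy).trans (mul_le_mul_of_nonneg_left (norm_sub_le_of_mem_segment hy) hC)
  calc
    _ ≤ C * ‖z - x‖ * ‖z - x‖ :=
      (convex_segment x z).norm_image_sub_le_of_norm_hasFDerivWithin_le'
        (fun y hy => (hf y hy).hasFDerivWithinAt) hbound
        (left_mem_segment ℝ x z) (right_mem_segment ℝ x z)
    _ = _ := by ring

lemma continuousOn_derivWithin_snd {𝕜 E F : Type*} [NontriviallyNormedField 𝕜]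
    [NormedAddCommGroup E] [NormedSpace 𝕜 E] [NormedAddCommGroup F] [NormedSpace 𝕜 F]
    {f : E → 𝕜 → F} {A : Set E} {J : Set 𝕜} (hJ : UniqueDiffOn 𝕜 J)
    (hf : ContDiffOn 𝕜 1 (fun q : E × 𝕜 => f q.1 q.2) (A ×ˢ J)) :
    ContinuousOn (fun q : E × 𝕜 => derivWithin (f q.1) J q.2) (A ×ˢ J) := by
  intro q hq
  have hq1 : ContDiffWithinAt 𝕜 (0 + 1) (fun q : E × 𝕜 => f q.1 q.2) (A ×ˢ J) q := by
    simpa using hf q hq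
  obtain ⟨u, hu, -, -, f', hf', hc⟩ :=
    (contDiffWithinAt_succ_iff_hasFDerivWithinAt' (by simp)).1 hq1
  rw [insert_eq_of_mem hq] at hu
  refine ((hc.continuousWithinAt.clm_apply continuousWithinAt_const).congr_of_eventuallyEq_of_mem
    (f := fun p => f' p (0, 1)) ?_ hq)
  filter_upwards [hu, self_mem_nhdsWithin] with p hpu hp
  have hline : HasDerivWithinAt (fun s => (p.1, s)) ((0 : E), (1 : 𝕜)) J p.2 :=
    (hasDerivWithinAt_const _ _ _).prodMk (hasDerivWithinAt_id _ _)
  exact ((hf' p hpu).comp_hasDerivWithinAt (f := fun s => (p.1, s)) p.2 hline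
    fun s hs => ⟨hp.1, hs⟩).derivWithin (hJ p.2 hp.2)

lemma exists_contDiff_hasCompactSupport_eqOn {E F : Type*} [NormedAddCommGroup E]
    [NormedSpace ℝ E] [FiniteDimensional ℝ E] [NormedAddCommGroup F] [NormedSpace ℝ F]
    {f : E → F} {U A : Set E} (hU : IsOpen U) (hUb : Bornology.IsBounded U)
    (hf : ContDiffOn ℝ ∞ f U) (hA : closure A ⊆ U) :
    ∃ g : E → F, ContDiff ℝ ∞ g ∧ HasCompactSupport g ∧ EqOn g f A := by
  obtain ⟨χ, h0, h1, -⟩ := exists_contMDiffMap_zero_one_nhds_of_isClosed (n := ⊤)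
    (modelWithCornersSelf ℝ E) hU.isClosed_compl isClosed_closure
    (disjoint_compl_left_iff_subset.2 hA)
  refine ⟨fun x => χ x • f x, contDiff_iff_contDiffAt.2 fun x => ?_,
    .intro hUb.isCompact_closure fun x hx => ?_, fun x hx => ?_⟩
  · by_cases hx : x ∈ U
    · exact χ.contMDiff.contDiff.contDiffAt.smul (hf.contDiffAt (hU.mem_nhds hx))
    · refine contDiffAt_const (c := (0 : F)) |>.congr_of_eventuallyEq ?_
      filter_upwards [h0.filter_mono (nhds_le_nhdsSet hx)] with y hy
      simp only [hy, zero_smul]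
  · simp only [h0.self_of_nhdsSet x fun h => hx (subset_closure h), zero_smul]
  · simp only [h1.self_of_nhdsSet x (subset_closure hx), one_smul]

end Calculus

section IntegralCurves

variable {E : Type*} [NormedAddCommGroup E] [NormedSpace ℝ E] {G : E → E} {C : NNReal}

lemma dist_le_of_hasDerivAt_lipschitz_of_le (hG : LipschitzWith C G) {γ₁ γ₂ : ℝ → E} {a b : ℝ}
    (hab : a ≤ b) (h₁ : ∀ s ∈ Icc a b, HasDerivAt γ₁ (G (γ₁ s)) s)
    (h₂ : ∀ s ∈ Icc a b, HasDerivAt γ₂ (G (γ₂ s)) s) :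
    dist (γ₁ b) (γ₂ b) ≤ dist (γ₁ a) (γ₂ a) * Real.exp (C * (b - a)) :=
  dist_le_of_trajectories_ODE (v := fun _ => G) (fun _ => hG)
    (fun s hs => (h₁ s hs).continuousAt.continuousWithinAt)
    (fun s hs => (h₁ s (Ico_subset_Icc_self hs)).hasDerivWithinAt)
    (fun s hs => (h₂ s hs).continuousAt.continuousWithinAt)
    (fun s hs => (h₂ s (Ico_subset_Icc_self hs)).hasDerivWithinAt)
    le_rfl b (right_mem_Icc.2 hab)

lemma dist_le_of_hasDerivAt_lipschitz (hG : LipschitzWith C G) {I : Set ℝ} (hI : OrdConnected I)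
    {γ₁ γ₂ : ℝ → E} (h₁ : ∀ s ∈ I, HasDerivAt γ₁ (G (γ₁ s)) s)
    (h₂ : ∀ s ∈ I, HasDerivAt γ₂ (G (γ₂ s)) s) {a b : ℝ} (ha : a ∈ I) (hb : b ∈ I) :
    dist (γ₁ b) (γ₂ b) ≤ dist (γ₁ a) (γ₂ a) * Real.exp (C * |b - a|) := by
  rcases le_total a b with hab | hba
  · rw [abs_of_nonneg (sub_nonneg.2 hab)]
    exact dist_le_of_hasDerivAt_lipschitz_of_le hG hab (fun s hs => h₁ s (hI.out ha hb hs))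
      fun s hs => h₂ s (hI.out ha hb hs)
  · have hneg : LipschitzWith C fun x => -G x := fun x y => by
      simpa only [edist_neg_neg] using hG x y
    have hreversed {γ : ℝ → E} (hγ : ∀ s ∈ I, HasDerivAt γ (G (γ s)) s) :
        ∀ s ∈ Icc (-a) (-b), HasDerivAt (fun s => γ (-s)) (-G (γ (-s))) s := fun s hs => by
      simpa only [neg_one_smul, Function.comp_def] using
        (hγ (-s) (hI.out hb ha ⟨by linarith [hs.2], by linarith [hs.1]⟩)).scomp s (hasDerivAt_neg s)
    have key := dist_le_of_hasDerivAt_lipschitz_of_le hneg (neg_le_neg hba)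
      (hreversed h₁) (hreversed h₂)
    simp only [neg_neg] at key
    rwa [abs_sub_comm, abs_of_nonneg (sub_nonneg.2 hba), show a - b = -b - -a by ring]

lemma exists_hasDerivWithinAt_of_lipschitz_of_bounded [CompleteSpace E] {L : NNReal}
    (hG : LipschitzWith C G) (hL : ∀ x, ‖G x‖ ≤ L) {a b t₀ : ℝ} (ht₀ : t₀ ∈ Icc a b) (x : E) :
    ∃ γ : ℝ → E, γ t₀ = x ∧ ∀ s ∈ Icc a b, HasDerivWithinAt γ (G (γ s)) (Icc a b) s := by
  have hpl : IsPicardLindelof (fun _ => G) (⟨t₀, ht₀⟩ : Icc a b) x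
      (L * (b - a).toNNReal) 0 L C :=
    { lipschitzOnWith := fun _ _ => hG.lipschitzOnWith
      continuousOn := fun _ _ => continuousOn_const
      norm_le := fun _ _ y _ => hL y
      mul_max_le := by
        have hab : 0 ≤ b - a := by linarith [ht₀.1, ht₀.2]
        simp only [NNReal.coe_mul, Real.coe_toNNReal _ hab, NNReal.coe_zero, sub_zero]
        exact mul_le_mul_of_nonneg_left
          (max_le (by linarith [ht₀.1]) (by linarith [ht₀.2])) L.2 }
  exact hpl.exists_eq_forall_mem_Icc_hasDerivWithinAt₀

end IntegralCurves

section UniqueSolvability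

lemma existsUnique_of_subtype {α : Type*} {V : Set α} {p : α → Prop}
    (h : ∃! u : V, p u) : ∃! u, u ∈ V ∧ p u := by
  obtain ⟨u, hu, huniq⟩ := h
  exact ⟨u, ⟨u.2, hu⟩, fun w hw => congrArg Subtype.val (huniq ⟨w, hw.1⟩ hw.2)⟩

lemma existsUnique_fin_recursion {α : Type*} {M : ℕ} {V : Fin (M + 1) → Set α} {p : α → Prop}
    {R : Fin M → α → α → Prop} (h₀ : ∃! a, a ∈ V 0 ∧ p a)
    (hR : ∀ m : Fin M, ∀ w ∈ V m.castSucc, ∃! a, a ∈ V m.succ ∧ R m w a) :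
    ∃! u : Fin (M + 1) → α, (∀ m, u m ∈ V m) ∧ p (u 0) ∧
      ∀ m : Fin M, R m (u m.castSucc) (u m.succ) := by
  obtain ⟨a₀, ⟨ha₀, hpa₀⟩, huniq₀⟩ := h₀
  choose next hnext huniq using hR
  let seq (m : Fin (M + 1)) : V m :=
    Fin.induction ⟨a₀, ha₀⟩ (fun m w => ⟨next m w w.2, (hnext m w w.2).1⟩) m
  have seq_succ (m : Fin M) : (seq m.succ : α) = next m (seq m.castSucc) (seq m.castSucc).2 := by
    simp only [seq, Fin.induction_succ]
  refine ⟨fun m => seq m, ⟨fun m => (seq m).2, hpa₀, fun m => ?_⟩, ?_⟩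
  · simpa only [seq_succ] using (hnext m _ (seq m.castSucc).2).2
  · rintro u ⟨huV, hu₀, huR⟩
    funext m
    induction m using Fin.induction with
    | zero => exact huniq₀ (u 0) ⟨huV 0, hu₀⟩
    | succ m ih =>
      rw [seq_succ]
      exact huniq m _ _ _ ⟨huV _, ih ▸ huR m⟩

variable {W : Type*} [AddCommGroup W] [Module ℝ W] [FiniteDimensional ℝ W]

lemma existsUnique_of_definite (B : W →ₗ[ℝ] W →ₗ[ℝ] ℝ) (hB : ∀ u, B u u = 0 → u = 0)
    (ℓ : W →ₗ[ℝ] ℝ) : ∃! u, ∀ v, B u v = ℓ v := by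
  have hinj : Function.Injective B :=
    (injective_iff_map_eq_zero B).2 fun u hu => hB u (by rw [hu, LinearMap.zero_apply])
  have hsurj : Function.Surjective B :=
    (LinearMap.injective_iff_surjective_of_finrank_eq_finrank
      (Subspace.dual_finrank_eq (K := ℝ) (V := W)).symm).1 hinj
  simpa only [LinearMap.ext_iff] using Function.Bijective.existsUnique ⟨hinj, hsurj⟩ ℓ

end UniqueSolvability

section IntegralForms

open scoped ENNReal

variable {W α E : Type*} [AddCommGroup W] [Module ℝ W] [MeasurableSpace α] {μ : Measure α}
  [NormedAddCommGroup E] [InnerProductSpace ℝ E]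

/-- A family of essentially bounded functions indexed by a vector space, depending linearly on the
index up to null sets. Finite element functions and their gradients are such families. -/
structure IsLinftyLinear (μ : Measure α) (X : W → α → E) : Prop where
  map_add : ∀ u v, X (u + v) =ᵐ[μ] X u + X v
  map_smul : ∀ (c : ℝ) u, X (c • u) =ᵐ[μ] c • X u
  memLp : ∀ u, MemLp (X u) ∞ μ

namespace IsLinftyLinear

variable {X Y : W → α → E}

lemma smul_left {a : α → ℝ} (hX : IsLinftyLinear μ X) (ha : MemLp a ∞ μ) :
    IsLinftyLinear μ fun u x => a x • X u x where
  map_add u v := by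
    filter_upwards [hX.map_add u v] with x hx
    simp only [hx, Pi.add_apply, smul_add]
  map_smul c u := by
    filter_upwards [hX.map_smul c u] with x hx
    rw [hx, Pi.smul_apply, Pi.smul_apply, smul_comm]
  memLp u := (hX.memLp u).smul ha

lemma inner_left {b : α → E} (hX : IsLinftyLinear μ X) (hb : MemLp b ∞ μ) :
    IsLinftyLinear μ fun u x => inner ℝ (b x) (X u x) where
  map_add u v := by
    filter_upwards [hX.map_add u v] with x hx
    simp only [hx, Pi.add_apply, inner_add_right]
  map_smul c u := by
    filter_upwards [hX.map_smul c u] with x hx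
    simp only [hx, Pi.smul_apply, real_inner_smul_right, smul_eq_mul]
  memLp u := hb.of_bilin _ 1 (hX.memLp u) (hb.1.inner (hX.memLp u).1) (.of_forall fun x => by
    simpa using nnnorm_inner_le_nnnorm (𝕜 := ℝ) (b x) (X u x))

lemma integrable_mul {g : α → ℝ} {X : W → α → ℝ} (hX : IsLinftyLinear μ X) (hg : Integrable g μ)
    (u : W) : Integrable (fun x => g x * X u x) μ :=
  hg.mul_of_top_left (hX.memLp u)

/-- The linear functional `v ↦ ∫ g X(v)` given by an integrable function `g`. -/
noncomputable def functional {g : α → ℝ} {X : W → α → ℝ} (hX : IsLinftyLinear μ X)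
    (hg : Integrable g μ) : W →ₗ[ℝ] ℝ where
  toFun v := ∫ x, g x * X v x ∂μ
  map_add' u v := by
    rw [← integral_add (hX.integrable_mul hg u) (hX.integrable_mul hg v)]
    refine integral_congr_ae ?_
    filter_upwards [hX.map_add u v] with x hx
    rw [hx, Pi.add_apply, mul_add]
  map_smul' c u := by
    rw [RingHom.id_apply, ← integral_smul]
    refine integral_congr_ae ?_
    filter_upwards [hX.map_smul c u] with x hx
    simp only [hx, Pi.smul_apply, smul_eq_mul, mul_left_comm]

variable [IsFiniteMeasure μ]

lemma integrable_inner (hX : IsLinftyLinear μ X) (hY : IsLinftyLinear μ Y) (u v : W) :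
    Integrable (fun x => inner ℝ (X u x) (Y v x)) μ :=
  ((hY.inner_left (hX.memLp u)).memLp v).integrable le_top

/-- The bilinear form `(u, v) ↦ ∫ ⟪X u, Y v⟫`, from which the terms of the scheme are built. -/
noncomputable def form (hX : IsLinftyLinear μ X) (hY : IsLinftyLinear μ Y) :
    W →ₗ[ℝ] W →ₗ[ℝ] ℝ :=
  LinearMap.mk₂ ℝ (fun u v => ∫ x, inner ℝ (X u x) (Y v x) ∂μ)
    (fun u u' v => by
      rw [← integral_add (hX.integrable_inner hY u v) (hX.integrable_inner hY u' v)]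
      refine integral_congr_ae ?_
      filter_upwards [hX.map_add u u'] with x hx
      rw [hx, Pi.add_apply, inner_add_left])
    (fun c u v => by
      rw [← integral_smul]
      refine integral_congr_ae ?_
      filter_upwards [hX.map_smul c u] with x hx
      rw [hx, Pi.smul_apply, real_inner_smul_left, smul_eq_mul])
    (fun u v v' => by
      rw [← integral_add (hX.integrable_inner hY u v) (hX.integrable_inner hY u v')]
      refine integral_congr_ae ?_
      filter_upwards [hY.map_add v v'] with x hx
      rw [hx, Pi.add_apply, inner_add_right])
    (fun c u v => by
      rw [← integral_smul]
      refine integral_congr_ae ?_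
      filter_upwards [hY.map_smul c v] with x hx
      rw [hx, Pi.smul_apply, real_inner_smul_right, smul_eq_mul])

lemma form_apply (hX : IsLinftyLinear μ X) (hY : IsLinftyLinear μ Y) (u v : W) :
    hX.form hY u v = ∫ x, inner ℝ (X u x) (Y v x) ∂μ := rfl

end IsLinftyLinear

end IntegralForms

section Young

lemma real_mul_inner_le_of_norm_le {E : Type*} [NormedAddCommGroup E] [InnerProductSpace ℝ E]
    {a C : ℝ} {b g : E} (hb : ‖b‖ ≤ C) :
    a * inner ℝ b g ≤ C ^ 2 / 4 * a ^ 2 + ‖g‖ ^ 2 :=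
  calc a * inner ℝ b g ≤ |a| * (C * ‖g‖) := by
        refine (le_abs_self _).trans ?_
        rw [abs_mul]
        gcongr
        exact (abs_real_inner_le_norm b g).trans (by gcongr)
    _ ≤ C ^ 2 / 4 * a ^ 2 + ‖g‖ ^ 2 := by
        rw [← sq_abs a]
        linarith [sq_nonneg (C / 2 * |a| - ‖g‖)]

lemma integral_mul_inner_mul_le {α E : Type*} [MeasurableSpace α] {μ : Measure α}
    [NormedAddCommGroup E] [InnerProductSpace ℝ E] {u w : α → ℝ} {b g : α → E} {C : ℝ}
    (hw : ∀ x, 0 ≤ w x) (hb : ∀ x, w x ≠ 0 → ‖b x‖ ≤ C)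
    (hu : Integrable (fun x => u x ^ 2 * w x) μ) (hg : Integrable (fun x => ‖g x‖ ^ 2 * w x) μ)
    (hbg : Integrable (fun x => u x * inner ℝ (b x) (g x) * w x) μ) :
    ∫ x, u x * inner ℝ (b x) (g x) * w x ∂μ ≤
      C ^ 2 / 4 * (∫ x, u x ^ 2 * w x ∂μ) + ∫ x, ‖g x‖ ^ 2 * w x ∂μ := by
  rw [← integral_const_mul, ← integral_add (hu.const_mul _) hg]
  refine integral_mono hbg ((hu.const_mul _).add hg) fun x => ?_
  rcases eq_or_ne (w x) 0 with hx | hx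
  · simp [hx]
  · calc u x * inner ℝ (b x) (g x) * w x ≤ (C ^ 2 / 4 * u x ^ 2 + ‖g x‖ ^ 2) * w x :=
          mul_le_mul_of_nonneg_right (real_mul_inner_le_of_norm_le (hb x hx)) (hw x)
      _ = C ^ 2 / 4 * (u x ^ 2 * w x) + ‖g x‖ ^ 2 * w x := by ring

end Young

namespace MovingSurface

variable {n : ℕ} (S : MovingSurface n) {t δ r : ℝ} {x : Amb n}

section LevelSets

lemma c₁_nonneg : 0 ≤ S.c₁ := S.c₀_pos.le.trans S.c₀_le

lemma contDiffOn_slice (ht : t ∈ Icc 0 S.T) : ContDiffOn ℝ ∞ (fun x => S.φ x t) S.Ω :=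
  S.smooth_φ.comp (f := fun x => (x, t)) (by fun_prop) fun _ hx => ⟨hx, ht⟩

lemma continuousAt_slice (ht : t ∈ Icc 0 S.T) (hx : x ∈ S.Ω) :
    ContinuousAt (fun y => S.φ y t) x :=
  (S.contDiffOn_slice ht).continuousOn.continuousAt (S.isOpen_Ω.mem_nhds hx)

lemma contDiffOn_gradAt (ht : t ∈ Icc 0 S.T) : ContDiffOn ℝ ∞ (fun x => gradAt S.φ x t) S.Ω :=
  (InnerProductSpace.toDual ℝ (Amb n)).symm.contDiff.comp_contDiffOn
    ((S.contDiffOn_slice ht).fderiv_of_isOpen S.isOpen_Ω (by simp))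

lemma hasFDerivAt_slice (ht : t ∈ Icc 0 S.T) (hx : x ∈ S.Ω) :
    HasFDerivAt (fun y => S.φ y t) (innerSL ℝ (gradAt S.φ x t)) x :=
  (((S.contDiffOn_slice ht).contDiffAt (S.isOpen_Ω.mem_nhds hx)).differentiableAt
    (by simp)).hasGradientAt

lemma differentiableAt_gradAt (ht : t ∈ Icc 0 S.T) (hx : x ∈ S.Ω) :
    DifferentiableAt ℝ (fun y => gradAt S.φ y t) x :=
  ((S.contDiffOn_gradAt ht).contDiffAt (S.isOpen_Ω.mem_nhds hx)).differentiableAt (by simp)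

lemma band_mono {r r' : ℝ} (h : r ≤ r') (t : ℝ) : S.band r t ⊆ S.band r' t :=
  fun _ hx => ⟨hx.1, hx.2.trans_le h⟩

lemma pos_of_mem_band (hx : x ∈ S.band r t) : 0 < r := (abs_nonneg _).trans_lt hx.2

lemma isOpen_band (ht : t ∈ Icc 0 S.T) (r : ℝ) : IsOpen (S.band r t) :=
  (S.contDiffOn_slice ht).continuousOn.abs.isOpen_inter_preimage S.isOpen_Ω isOpen_Iio

lemma abs_le_of_mem_closure_band (ht : t ∈ Icc 0 S.T) (hr : r ≤ S.δ₀)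
    (hx : x ∈ closure (S.band r t)) : x ∈ S.Ω ∧ |S.φ x t| ≤ r := by
  have hxΩ : x ∈ S.Ω := S.closure_band t ht (closure_mono (S.band_mono hr t) hx)
  have himage := mem_closure_image (S.continuousAt_slice ht hxΩ).abs hx
  exact ⟨hxΩ, closure_minimal (image_subset_iff.2 fun y hy => hy.2.le) isClosed_Iic himage⟩

lemma closure_band_subset_band {δ' : ℝ} (ht : t ∈ Icc 0 S.T) (hδ : δ < δ') (hδ' : δ' ≤ S.δ₀) :
    closure (S.band δ t) ⊆ S.band δ' t := fun _ hx =>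
  have h := S.abs_le_of_mem_closure_band ht (hδ.le.trans hδ') hx
  ⟨h.1, h.2.trans_lt hδ⟩

lemma gradAt_ne_zero (ht : t ∈ Icc 0 S.T) (hx : x ∈ S.band S.δ₀ t) : gradAt S.φ x t ≠ 0 :=
  norm_pos_iff.1 (S.c₀_pos.trans_le (S.grad_lower t ht x hx))

lemma add_mem_band (ht : t ∈ Icc 0 S.T) {v : Amb n} (hx : x ∈ S.band δ t)
    (hv : δ + S.c₁ * ‖v‖ ≤ S.δ₀) : x + v ∈ S.band S.δ₀ t := by
  have hline (r : ℝ) : HasDerivAt (fun r : ℝ => x + r • v) v r := by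
    simpa using ((hasDerivAt_id r).smul_const v).const_add x
  have hcont : Continuous fun r : ℝ => x + r • v := by fun_prop
  have hc₁v : 0 ≤ S.c₁ * ‖v‖ := mul_nonneg S.c₁_nonneg (norm_nonneg v)
  by_contra hmem
  obtain ⟨s, hs, hsnot, hlt⟩ := exists_first_exit hcont (S.isOpen_band ht S.δ₀) zero_le_one
    (by simpa using S.band_mono (by linarith) t hx) (by simpa using hmem)
  have hsΩ : x + s • v ∈ S.Ω := by
    refine S.closure_band t ht
      (map_mem_closure hcont (s := Ico 0 s) ?_ fun r hr => hlt r hr)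
    rw [closure_Ico hs.1.ne]
    exact right_mem_Icc.2 hs.1.le
  have hΩ : ∀ r ∈ Icc 0 s, x + r • v ∈ S.Ω := fun r hr => by
    rcases hr.2.eq_or_lt with h | h
    · exact h ▸ hsΩ
    · exact (hlt r ⟨hr.1, h⟩).1
  have hderiv : ∀ r ∈ Icc 0 s, HasDerivAt (fun r : ℝ => S.φ (x + r • v) t)
      (inner ℝ (gradAt S.φ (x + r • v) t) v) r := fun r hr =>
    HasFDerivAt.comp_hasDerivAt (f := fun r : ℝ => x + r • v) r
      (S.hasFDerivAt_slice ht (hΩ r hr)) (hline r)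
  have hmove := norm_image_sub_le_of_norm_deriv_le_segment'
    (fun r hr => (hderiv r hr).hasDerivWithinAt)
    (fun r hr => (abs_real_inner_le_norm _ _).trans (mul_le_mul_of_nonneg_right
      (S.grad_upper t ht _ (hlt r hr)) (norm_nonneg v))) s (right_mem_Icc.2 hs.1.le)
  simp only [zero_smul, add_zero, sub_zero, Real.norm_eq_abs] at hmove
  refine hsnot ⟨hsΩ, ?_⟩
  calc |S.φ (x + s • v) t| ≤ |S.φ x t| + S.c₁ * ‖v‖ * s := by
        linarith [abs_sub_abs_le_abs_sub (S.φ (x + s • v) t) (S.φ x t)]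
    _ ≤ |S.φ x t| + S.c₁ * ‖v‖ := by linarith [mul_le_of_le_one_right hc₁v hs.2]
    _ < S.δ₀ := by have := hx.2; linarith

lemma closedBall_subset_band (ht : t ∈ Icc 0 S.T) (hx : x ∈ S.band δ t)
    (hr : δ + S.c₁ * r ≤ S.δ₀) : Metric.closedBall x r ⊆ S.band S.δ₀ t := fun y hy => by
  have hyr : S.c₁ * ‖y - x‖ ≤ S.c₁ * r :=
    mul_le_mul_of_nonneg_left (mem_closedBall_iff_norm.1 hy) S.c₁_nonneg
  simpa using S.add_mem_band ht (v := y - x) hx (by linarith)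

lemma abs_sub_sub_inner_gradAt_le (ht : t ∈ Icc 0 S.T) {z : Amb n} (hx : x ∈ S.band δ t)
    (hz : δ + S.c₁ * ‖z - x‖ ≤ S.δ₀) :
    |S.φ z t - S.φ x t - inner ℝ (gradAt S.φ x t) (z - x)| ≤ S.c₂ * ‖z - x‖ ^ 2 := by
  have hball := S.closedBall_subset_band ht hx hz
  have hseg : segment ℝ x z ⊆ Metric.closedBall x ‖z - x‖ :=
    (convex_closedBall x _).segment_subset (Metric.mem_closedBall_self (norm_nonneg _))
      (mem_closedBall_iff_norm.2 le_rfl)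
  refine norm_image_sub_sub_fderiv_le_of_lipschitz (f := fun y => S.φ y t)
    (f' := fun y => innerSL ℝ (gradAt S.φ y t))
    (fun y hy => S.hasFDerivAt_slice ht (hball (hseg hy)).1) S.c₂_pos.le fun y hy => ?_
  rw [← map_sub, innerSL_apply_norm]
  exact (convex_closedBall x ‖z - x‖).norm_image_sub_le_of_norm_fderiv_le (𝕜 := ℝ)
    (fun w hw => S.differentiableAt_gradAt ht (hball hw).1)
    (fun w hw => S.hess_upper t ht w (hball hw))
    (Metric.mem_closedBall_self (norm_nonneg _)) (hseg hy)

lemma surf_subset_band (hr : 0 < r) : S.surf t ⊆ S.band r t := fun y hy =>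
  ⟨hy.1, by rwa [hy.2, abs_zero]⟩

lemma isCompact_surf (ht : t ∈ Icc 0 S.T) : IsCompact (S.surf t) := by
  refine Metric.isCompact_of_isClosed_isBounded (isClosed_of_closure_subset fun x hx => ?_)
    (S.isBounded_Ω.subset fun x hx => hx.1)
  have hxΩ : x ∈ S.Ω := S.closure_band t ht (closure_mono (S.surf_subset_band S.δ₀_pos) hx)
  have himage := mem_closure_image (S.continuousAt_slice ht hxΩ) hx
  exact ⟨hxΩ, closure_minimal (t := {0}) (image_subset_iff.2 fun y hy => hy.2)
    isClosed_singleton himage⟩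

end LevelSets

section NormalCurves

/-- The field `∇φ / |∇φ|²`, whose integral curves are the normal curves. -/
noncomputable def normalField (x : Amb n) (t : ℝ) : Amb n :=
  (‖gradAt S.φ x t‖ ^ 2)⁻¹ • gradAt S.φ x t

lemma inner_gradAt_normalField (hx : gradAt S.φ x t ≠ 0) :
    inner ℝ (gradAt S.φ x t) (S.normalField x t) = 1 := by
  rw [normalField, inner_smul_right, real_inner_self_eq_norm_sq]
  exact inv_mul_cancel₀ (pow_ne_zero 2 (norm_ne_zero_iff.2 hx))

lemma contDiffOn_normalField (ht : t ∈ Icc 0 S.T) :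
    ContDiffOn ℝ ∞ (fun x => S.normalField x t) (S.band S.δ₀ t) := by
  have hgrad := (S.contDiffOn_gradAt ht).mono fun x (hx : x ∈ S.band S.δ₀ t) => hx.1
  exact ((hgrad.norm_sq ℝ).inv fun x hx => by simpa using S.gradAt_ne_zero ht hx).smul hgrad

lemma exists_lipschitz_normalField (ht : t ∈ Icc 0 S.T) (hδ : δ < S.δ₀) :
    ∃ (G : Amb n → Amb n) (C L : NNReal), LipschitzWith C G ∧ (∀ x, ‖G x‖ ≤ L) ∧
      ∀ x ∈ S.band δ t, G x = S.normalField x t := by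
  obtain ⟨G, hG, hGc, hGeq⟩ := exists_contDiff_hasCompactSupport_eqOn (S.isOpen_band ht S.δ₀)
    (S.isBounded_Ω.subset fun x hx => hx.1) (S.contDiffOn_normalField ht)
    (S.closure_band_subset_band ht hδ le_rfl)
  obtain ⟨C, hC⟩ := hG.lipschitzWith_of_hasCompactSupport hGc (by simp)
  obtain ⟨L, hL⟩ := hGc.exists_bound_of_continuous hG.continuous
  exact ⟨G, C, L.toNNReal, hC, fun x => (hL x).trans (Real.le_coe_toNNReal L), hGeq⟩

variable {γ : ℝ → Amb n} {s s₀ : ℝ}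

lemma hasDerivAt_comp_of_normalField (ht : t ∈ Icc 0 S.T) (hs : γ s ∈ S.band S.δ₀ t)
    (hγ : HasDerivAt γ (S.normalField (γ s) t) s) : HasDerivAt (fun s => S.φ (γ s) t) 1 s := by
  rw [← S.inner_gradAt_normalField (S.gradAt_ne_zero ht hs)]
  exact (S.hasFDerivAt_slice ht hs.1).comp_hasDerivAt s hγ

lemma eventually_slice_eq_param (ht : t ∈ Icc 0 S.T) (hδ : δ ≤ S.δ₀) (hc : ContinuousAt γ s)
    (hγ : ∀ᶠ r in 𝓝 s, γ r ∈ S.band δ t → HasDerivAt γ (S.normalField (γ r) t) r)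
    (hs : γ s ∈ S.band δ t) (hφ : S.φ (γ s) t = s) :
    ∀ᶠ r in 𝓝 s, γ r ∈ S.band δ t ∧ S.φ (γ r) t = r := by
  have hmem := hc.eventually_mem ((S.isOpen_band ht δ).mem_nhds hs)
  have hderiv : ∀ᶠ r in 𝓝 s, HasDerivAt (fun q => S.φ (γ q) t - q) 0 r := by
    filter_upwards [hmem, hγ] with r hr hγr
    simpa using (S.hasDerivAt_comp_of_normalField ht (S.band_mono hδ t hr) (hγr hr)).fun_sub
      (hasDerivAt_id' r)
  obtain ⟨η, hη, hball⟩ := Metric.eventually_nhds_iff_ball.1 hderiv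
  filter_upwards [hmem, Metric.ball_mem_nhds s hη] with r hr hrη
  have hconst := Metric.isOpen_ball.is_const_of_deriv_eq_zero (convex_ball s η).isPreconnected
    (fun q hq => (hball q hq).differentiableAt.differentiableWithinAt)
    (fun q hq => (hball q hq).deriv) hrη (Metric.mem_ball_self hη)
  exact ⟨hr, by linarith⟩

lemma slice_eq_param_of_mem_closure (ht : t ∈ Icc 0 S.T) (hδ : δ ≤ S.δ₀) (hc : ContinuousAt γ s)
    (hs : s ∈ closure {r | γ r ∈ S.band δ t ∧ S.φ (γ r) t = r}) :
    γ s ∈ S.Ω ∧ S.φ (γ s) t = s := by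
  have hfreq := mem_closure_iff_frequently.1 hs
  have hΩ : γ s ∈ S.Ω := (S.abs_le_of_mem_closure_band ht hδ
    (mem_closure_of_frequently_of_tendsto (hfreq.mono fun _ hr => hr.1) hc)).1
  exact ⟨hΩ, tendsto_nhds_unique_of_frequently_eq ((S.continuousAt_slice ht hΩ).tendsto.comp hc)
    tendsto_id (hfreq.mono fun _ hr => hr.2)⟩

/-- The field is only assumed to drive the curve while the latter stays in the band, so that the
lemma also applies to integral curves of an extension of the field. -/
lemma slice_eq_param (ht : t ∈ Icc 0 S.T) (hδ : δ ≤ S.δ₀) (hc : ContinuousOn γ (Ioo (-δ) δ))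
    (hγ : ∀ s ∈ Ioo (-δ) δ, γ s ∈ S.band δ t → HasDerivAt γ (S.normalField (γ s) t) s)
    (hs₀ : s₀ ∈ Ioo (-δ) δ) (hΩ : γ s₀ ∈ S.Ω) (hφ : S.φ (γ s₀) t = s₀) :
    ∀ s ∈ Ioo (-δ) δ, γ s ∈ S.band δ t ∧ S.φ (γ s) t = s := by
  have hmem {s : ℝ} (hs : s ∈ Ioo (-δ) δ) (h : γ s ∈ S.Ω ∧ S.φ (γ s) t = s) :
      γ s ∈ S.band δ t ∧ S.φ (γ s) t = s :=
    ⟨⟨h.1, by simpa only [h.2] using abs_lt.2 hs⟩, h.2⟩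
  have hcAt {s : ℝ} (hs : s ∈ Ioo (-δ) δ) : ContinuousAt γ s :=
    hc.continuousAt (isOpen_Ioo.mem_nhds hs)
  have hsub : Ioo (-δ) δ ⊆ interior {s | γ s ∈ S.band δ t ∧ S.φ (γ s) t = s} := by
    have hlevel : ∀ s ∈ Ioo (-δ) δ, γ s ∈ S.Ω ∧ S.φ (γ s) t = s →
        s ∈ interior {s | γ s ∈ S.band δ t ∧ S.φ (γ s) t = s} := fun s hs h =>
      mem_interior_iff_mem_nhds.2 <| S.eventually_slice_eq_param ht hδ (hcAt hs)
        (eventually_of_mem (isOpen_Ioo.mem_nhds hs) hγ) (hmem hs h).1 h.2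
    exact isPreconnected_Ioo.subset_of_closure_inter_subset isOpen_interior
      ⟨s₀, hs₀, hlevel s₀ hs₀ ⟨hΩ, hφ⟩⟩ fun s hs => hlevel s hs.2 <|
        S.slice_eq_param_of_mem_closure ht hδ (hcAt hs.2) (closure_mono interior_subset hs.1)
  exact hsub.trans interior_subset

lemma IsNormalCurve.mem_band {S : MovingSurface n} (ht : t ∈ Icc 0 S.T) (hδ : δ ≤ S.δ₀)
    {y : Amb n} (hy : y ∈ S.surf t) (hγ : S.IsNormalCurve δ t y γ) :
    ∀ s ∈ Ioo (-δ) δ, γ s ∈ S.band δ t := fun s hs => by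
  have h0 : (0 : ℝ) ∈ Ioo (-δ) δ := by
    constructor <;> linarith [hs.1, hs.2]
  exact (S.slice_eq_param ht hδ (fun s hs => (hγ.2 s hs).2.continuousAt.continuousWithinAt)
    (fun s hs _ => (hγ.2 s hs).2) h0 (hγ.2 0 h0).1 (by rw [hγ.1, hy.2]) s hs).1

lemma exists_isNormalCurve (ht : t ∈ Icc 0 S.T) (hδ : δ < S.δ₀) (hx : x ∈ S.band δ t) :
    ∃ y ∈ S.surf t, ∃ γ, S.IsNormalCurve δ t y γ ∧ γ (S.φ x t) = x := by
  obtain ⟨G, C, L, hGC, hGL, hG⟩ := S.exists_lipschitz_normalField ht hδ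
  have hφx := abs_lt.1 hx.2
  obtain ⟨γ, hγx, hγ⟩ := exists_hasDerivWithinAt_of_lipschitz_of_bounded hGC hGL
    (a := -δ) (b := δ) ⟨hφx.1.le, hφx.2.le⟩ x
  have hderiv : ∀ s ∈ Ioo (-δ) δ, HasDerivAt γ (G (γ s)) s := fun s hs =>
    (hγ s (Ioo_subset_Icc_self hs)).hasDerivAt (Icc_mem_nhds hs.1 hs.2)
  have hlevel := S.slice_eq_param ht hδ.le
    (fun s hs => (hderiv s hs).continuousAt.continuousWithinAt)
    (fun s hs hb => hG _ hb ▸ hderiv s hs) hφx (by rw [hγx]; exact hx.1) (by rw [hγx])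
  have h0 : (0 : ℝ) ∈ Ioo (-δ) δ := by
    constructor <;> linarith [hφx.1, hφx.2]
  refine ⟨γ 0, ⟨(hlevel 0 h0).1.1, (hlevel 0 h0).2⟩, γ,
    ⟨rfl, fun s hs => ⟨(hlevel s hs).1.1, ?_⟩⟩, hγx⟩
  rw [← normalField, ← hG _ (hlevel s hs).1]
  exact hderiv s hs

lemma label_spec (ht : t ∈ Icc 0 S.T) (hδ : δ < S.δ₀) (hx : x ∈ S.band δ t) :
    S.label δ x t ∈ S.surf 0 ∧
      ∃ γ : ℝ → Amb n, S.IsNormalCurve δ t (S.proj δ x t) γ ∧ γ (S.φ x t) = x := by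
  obtain ⟨y, hy, γ, hγ, hγx⟩ := S.exists_isNormalCurve ht hδ hx
  obtain ⟨P, hP, rfl⟩ := (S.bijOn_Φ t ht).surjOn hy
  exact Classical.epsilon_spec (p := fun P => P ∈ S.surf 0 ∧
    ∃ γ : ℝ → Amb n, S.IsNormalCurve δ t (S.Φ P t) γ ∧ γ (S.φ x t) = x) ⟨P, hP, γ, hγ, hγx⟩

lemma proj_mem_surf (ht : t ∈ Icc 0 S.T) (hδ : δ < S.δ₀) (hx : x ∈ S.band δ t) :
    S.proj δ x t ∈ S.surf t :=
  (S.bijOn_Φ t ht).mapsTo (S.label_spec ht hδ hx).1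

lemma exists_integralCurve_proj (ht : t ∈ Icc 0 S.T) (hδ : δ < S.δ₀) {G : Amb n → Amb n}
    (hG : ∀ x ∈ S.band δ t, G x = S.normalField x t) (hx : x ∈ S.band δ t) :
    ∃ γ : ℝ → Amb n, γ 0 = S.proj δ x t ∧ γ (S.φ x t) = x ∧
      ∀ s ∈ Ioo (-δ) δ, HasDerivAt γ (G (γ s)) s := by
  obtain ⟨-, γ, hγ, hγx⟩ := S.label_spec ht hδ hx
  refine ⟨γ, hγ.1, hγx, fun s hs => ?_⟩
  rw [hG _ (hγ.mem_band ht hδ.le (S.proj_mem_surf ht hδ hx) s hs)]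
  exact (hγ.2 s hs).2

/-- Both `p̃(x)` and `p̃(z)` are reached by running the normal field backwards, from `z` and from
the point at level `φ(z)` on the curve through `x`; Grönwall compares the two. -/
lemma continuousOn_proj (ht : t ∈ Icc 0 S.T) (hδ : δ < S.δ₀) :
    ContinuousOn (fun x => S.proj δ x t) (S.band δ t) := by
  obtain ⟨G, C, L, hGC, -, hG⟩ := S.exists_lipschitz_normalField ht hδ
  intro x hx
  obtain ⟨γ, hγ0, hγx, hγ⟩ := S.exists_integralCurve_proj ht hδ hG hx
  have hcφ : ContinuousAt (fun z => S.φ z t) x := S.continuousAt_slice ht hx.1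
  have hcγ : ContinuousAt (fun z => γ (S.φ z t)) x :=
    (hγ _ (abs_lt.1 hx.2)).continuousAt.comp (f := fun z => S.φ z t) hcφ
  have hlim : Tendsto (fun z => dist z (γ (S.φ z t)) * Real.exp (C * |0 - S.φ z t|)) (𝓝 x)
      (𝓝 0) := by
    have hcont : ContinuousAt (fun z => dist z (γ (S.φ z t)) * Real.exp (C * |0 - S.φ z t|)) x :=
      (continuousAt_id.dist hcγ).mul
        (Real.continuous_exp.continuousAt.comp (continuousAt_const.mul
          (continuousAt_const.sub hcφ).abs))
    simpa [hγx] using hcont.tendsto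
  refine tendsto_iff_dist_tendsto_zero.2 (squeeze_zero' (Eventually.of_forall fun _ => dist_nonneg)
    ?_ (hlim.mono_left nhdsWithin_le_nhds))
  filter_upwards [self_mem_nhdsWithin] with z hz
  obtain ⟨η, hη0, hηz, hη⟩ := S.exists_integralCurve_proj ht hδ hG hz
  have h0 : (0 : ℝ) ∈ Ioo (-δ) δ := by
    constructor <;> linarith [S.pos_of_mem_band hz]
  have hdist := dist_le_of_hasDerivAt_lipschitz hGC ordConnected_Ioo hη hγ (abs_lt.1 hz.2) h0
  rwa [hη0, hγ0, hηz] at hdist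

end NormalCurves

end MovingSurface

namespace MovingSurface

variable {n : ℕ} (S : MovingSurface n) {t δ : ℝ}

section Velocity

lemma vel_flow {P : Amb n} (ht : t ∈ Ioc 0 S.T) (hP : P ∈ S.surf 0) :
    S.vel (S.Φ P t) t = derivWithin (S.Φ P) (Icc 0 S.T) t :=
  ((S.flow t ht P hP).derivWithin (uniqueDiffOn_Icc S.T_pos t (Ioc_subset_Icc_self ht))).symm

lemma continuousOn_flowVelocity :
    ContinuousOn (fun q : Amb n × ℝ => derivWithin (S.Φ q.1) (Icc 0 S.T) q.2)
      (S.surf 0 ×ˢ Icc 0 S.T) :=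
  continuousOn_derivWithin_snd (uniqueDiffOn_Icc S.T_pos) (S.smooth_Φ.of_le (by simp))

lemma exists_bound_vel : ∃ C : ℝ, ∀ t ∈ Ioc 0 S.T, ∀ y ∈ S.surf t, ‖S.vel y t‖ ≤ C := by
  have hcomp : IsCompact (S.surf 0 ×ˢ Icc 0 S.T) :=
    (S.isCompact_surf (left_mem_Icc.2 S.T_pos.le)).prod isCompact_Icc
  obtain ⟨C, hC⟩ := hcomp.exists_bound_of_continuousOn S.continuousOn_flowVelocity
  refine ⟨C, fun t ht y hy => ?_⟩
  obtain ⟨P, hP, rfl⟩ := (S.bijOn_Φ t (Ioc_subset_Icc_self ht)).surjOn hy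
  rw [S.vel_flow ht hP]
  exact hC (P, t) ⟨hP, Ioc_subset_Icc_self ht⟩

lemma continuousOn_vel (ht : t ∈ Ioc 0 S.T) : ContinuousOn (fun y => S.vel y t) (S.surf t) := by
  have ht' := Ioc_subset_Icc_self ht
  have hlabel : ∀ y ∈ S.surf t,
      Function.invFunOn (fun P => S.Φ P t) (zeroSet S.Ω S.φ 0) y ∈ S.surf 0 := fun y hy =>
    Function.invFunOn_mem ((S.bijOn_Φ t ht').surjOn hy)
  refine (S.continuousOn_flowVelocity.comp
    ((S.smooth_Φ_inv t ht').continuousOn.prodMk continuousOn_const)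
    fun y hy => ⟨hlabel y hy, ht'⟩).congr fun y hy => ?_
  rw [Function.comp_apply, ← S.vel_flow ht (hlabel y hy),
    Function.invFunOn_eq ((S.bijOn_Φ t ht').surjOn hy)]

lemma continuousOn_gradAt (ht : t ∈ Icc 0 S.T) :
    ContinuousOn (fun x => gradAt S.φ x t) (S.band S.δ₀ t) :=
  (S.contDiffOn_gradAt ht).continuousOn.mono fun _ hx => hx.1

lemma continuousOn_normal (ht : t ∈ Icc 0 S.T) :
    ContinuousOn (fun x => S.normal x t) (S.band S.δ₀ t) :=
  ((S.continuousOn_gradAt ht).norm.inv₀ fun _ hx =>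
    norm_ne_zero_iff.2 (S.gradAt_ne_zero ht hx)).smul (S.continuousOn_gradAt ht)

lemma norm_normal_le (x : Amb n) (t : ℝ) : ‖S.normal x t‖ ≤ 1 := by
  rw [normal, norm_smul, norm_inv, norm_norm]
  exact inv_mul_le_one

lemma continuousOn_normalVel (ht : t ∈ Icc 0 S.T) :
    ContinuousOn (fun x => S.normalVel x t) (S.band S.δ₀ t) := by
  have hdt : ContinuousOn (fun x => derivWithin (fun s => S.φ x s) (Icc 0 S.T) t)
      (S.band S.δ₀ t) :=
    (continuousOn_derivWithin_snd (uniqueDiffOn_Icc S.T_pos) (S.smooth_φ.of_le (by simp))).comp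
      (f := fun x => (x, t)) (by fun_prop) fun x hx => ⟨hx.1, ht⟩
  exact hdt.neg.div (S.continuousOn_gradAt ht).norm fun x hx =>
    norm_ne_zero_iff.2 (S.gradAt_ne_zero ht hx)

lemma norm_normalVel_le (ht : t ∈ Icc 0 S.T) {x : Amb n} (hx : x ∈ S.band S.δ₀ t) :
    ‖S.normalVel x t‖ ≤ S.c₂ / S.c₀ := by
  rw [normalVel, norm_div, norm_neg, norm_norm]
  exact div_le_div₀ S.c₂_pos.le (S.dt_upper t ht x hx) S.c₀_pos (S.grad_lower t ht x hx)

lemma norm_tangProj_le (x : Amb n) (t : ℝ) (w : Amb n) : ‖S.tangProj x t w‖ ≤ ‖w‖ := by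
  have hν : ‖S.normal x t‖ ^ 2 ≤ 1 := pow_le_one₀ (norm_nonneg _) (S.norm_normal_le x t)
  have hexpand : ‖S.tangProj x t w‖ ^ 2 =
      ‖w‖ ^ 2 - (2 - ‖S.normal x t‖ ^ 2) * (inner ℝ (S.normal x t) w) ^ 2 := by
    rw [tangProj, norm_sub_sq_real, real_inner_smul_right, real_inner_comm, norm_smul, mul_pow,
      Real.norm_eq_abs, sq_abs]
    ring
  refine le_of_sq_le_sq ?_ (norm_nonneg w)
  rw [hexpand]
  linarith [mul_nonneg (by linarith : 0 ≤ 2 - ‖S.normal x t‖ ^ 2)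
    (sq_nonneg (inner ℝ (S.normal x t) w))]

lemma continuousOn_tangProj {α : Type*} [TopologicalSpace α] {A : Set α} {p w : α → Amb n}
    (ht : t ∈ Icc 0 S.T) (hp : ContinuousOn p A) (hpA : MapsTo p A (S.band S.δ₀ t))
    (hw : ContinuousOn w A) : ContinuousOn (fun x => S.tangProj (p x) t (w x)) A :=
  have hν := (S.continuousOn_normal ht).comp hp hpA
  hw.sub ((hν.inner (𝕜 := ℝ) hw).smul hν)

lemma continuousOn_velExt (ht : t ∈ Ioc 0 S.T) (hδ : δ < S.δ₀) :
    ContinuousOn (fun x => S.velExt δ x t) (S.band δ t) := by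
  have ht' := Ioc_subset_Icc_self ht
  have hsub := S.band_mono hδ.le t
  have hproj := S.continuousOn_proj ht' hδ
  have hmaps : MapsTo (fun x => S.proj δ x t) (S.band δ t) (S.surf t) := fun x hx =>
    S.proj_mem_surf ht' hδ hx
  exact (((S.continuousOn_normalVel ht').smul (S.continuousOn_normal ht')).mono hsub).add
    (S.continuousOn_tangProj ht' continuousOn_id hsub
      (S.continuousOn_tangProj ht' hproj (hmaps.mono_right (S.surf_subset_band S.δ₀_pos))
        ((S.continuousOn_vel ht).comp hproj hmaps)))

lemma exists_bound_velExt (hδ : δ < S.δ₀) :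
    ∃ C : ℝ, ∀ t ∈ Ioc 0 S.T, ∀ x ∈ S.band δ t, ‖S.velExt δ x t‖ ≤ C := by
  obtain ⟨C, hC⟩ := S.exists_bound_vel
  refine ⟨S.c₂ / S.c₀ + C, fun t ht x hx => (norm_add_le _ _).trans (add_le_add ?_ ?_)⟩
  · rw [norm_smul]
    exact (mul_le_of_le_one_right (norm_nonneg _) (S.norm_normal_le x t)).trans
      (S.norm_normalVel_le (Ioc_subset_Icc_self ht) (S.band_mono hδ.le t hx))
  · exact ((S.norm_tangProj_le _ _ _).trans (S.norm_tangProj_le _ _ _)).trans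
      (hC t ht _ (S.proj_mem_surf (Ioc_subset_Icc_self ht) hδ hx))

end Velocity

end MovingSurface

section AffineBases

variable {ι V : Type*} [NormedAddCommGroup V]

lemma exists_affineMap_eq_on_affineBasis [Finite ι] [NormedSpace ℝ V] (b : AffineBasis ι ℝ V)
    (f : ι → ℝ) : ∃ A : V →ᵃ[ℝ] ℝ, ∀ i, A (b i) = f i := by
  classical
  cases nonempty_fintype ι
  refine ⟨(Fintype.linearCombination ℝ f).toAffineMap.comp b.coords, fun i => ?_⟩
  have hcoords : b.coords (b i) = Pi.single i 1 := by
    ext j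
    rw [b.coords_apply, b.coord_apply, Pi.single_apply]
  rw [AffineMap.comp_apply, hcoords, LinearMap.coe_toAffineMap,
    Fintype.linearCombination_apply_single, one_smul]

lemma mul_coord_linear_le_norm [Finite ι] [NormedSpace ℝ V] (b : AffineBasis ι ℝ V) {c : V}
    {q : ℝ} (hq : 0 ≤ q) (hball : Metric.closedBall c q ⊆ convexHull ℝ (range b)) (i : ι) (v : V) :
    q * (b.coord i).linear v ≤ ‖v‖ := by
  cases nonempty_fintype ι
  have hcoord : ∀ x ∈ Metric.closedBall c q, b.coord i x ∈ Icc (0 : ℝ) 1 := fun x hx => by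
    have hpos : ∀ j, 0 ≤ b.coord j x := b.convexHull_eq_nonneg_coord.subset (hball hx)
    exact ⟨hpos i, (Finset.single_le_sum (fun j _ => hpos j) (Finset.mem_univ i)).trans_eq
      (b.sum_coord_apply_eq_one x)⟩
  rcases eq_or_ne v 0 with rfl | hv
  · simp
  have hv' : 0 < ‖v‖ := norm_pos_iff.2 hv
  have hstep : b.coord i ((q / ‖v‖) • v +ᵥ c) = q / ‖v‖ * (b.coord i).linear v + b.coord i c := by
    rw [AffineMap.map_vadd, map_smul, smul_eq_mul, vadd_eq_add]
  have hend := hcoord ((q / ‖v‖) • v +ᵥ c) (by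
    simp [norm_smul, abs_of_nonneg hq, hv'.ne'])
  have hstart := hcoord c (Metric.mem_closedBall_self hq)
  rw [← div_le_one hv', mul_div_right_comm]
  linarith [hend.2, hstart.1]

lemma exists_mul_norm_le_card_mul_inner_sub [Fintype ι] [InnerProductSpace ℝ V]
    (b : AffineBasis ι ℝ V) {c v : V} {q : ℝ} (hq : 0 ≤ q)
    (hball : Metric.closedBall c q ⊆ convexHull ℝ (range b)) (hv : v ≠ 0) {i : ι}
    (hi : b i + v ∈ convexHull ℝ (range b)) :
    ∃ j, q * ‖v‖ ≤ Fintype.card ι * inner ℝ v (b j - b i) := by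
  by_contra! hcon
  set a : ι → ℝ := fun j => b.coord j (b i + v)
  have ha : ∀ j, 0 ≤ a j := b.convexHull_eq_nonneg_coord.subset hi
  have ha_le : ∀ j ≠ i, q * a j ≤ ‖v‖ := fun j hj => by
    have hlin : a j = (b.coord j).linear v := by
      simpa only [vadd_eq_add, add_comm v, b.coord_apply_ne hj, add_zero]
        using (b.coord j).map_vadd (b i) v
    exact hlin ▸ mul_coord_linear_le_norm b hq hball j v
  have hsum : ∑ j, a j * inner ℝ v (b j - b i) = ‖v‖ ^ 2 := by
    have hcomb : ∑ j, a j • (b j - b i) = v := by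
      simp only [smul_sub, Finset.sum_sub_distrib, ← Finset.sum_smul, a,
        b.linear_combination_coord_eq_self, b.sum_coord_apply_eq_one, one_smul,
        add_sub_cancel_left]
    rw [← real_inner_self_eq_norm_sq, ← congrArg (inner ℝ v) hcomb, inner_sum]
    simp only [real_inner_smul_right]
  have hterm : ∀ j ≠ i, Fintype.card ι * (a j * inner ℝ v (b j - b i)) ≤ ‖v‖ ^ 2 := fun j hj =>
    calc Fintype.card ι * (a j * inner ℝ v (b j - b i))
        = a j * (Fintype.card ι * inner ℝ v (b j - b i)) := by ring
      _ ≤ a j * (q * ‖v‖) := mul_le_mul_of_nonneg_left (hcon j).le (ha j)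
      _ = q * a j * ‖v‖ := by ring
      _ ≤ ‖v‖ ^ 2 := (mul_le_mul_of_nonneg_right (ha_le j hj) (norm_nonneg v)).trans_eq
        (sq ‖v‖).symm
  have hi₀ : Fintype.card ι * (a i * inner ℝ v (b i - b i)) < ‖v‖ ^ 2 := by
    simpa using pow_pos (norm_pos_iff.2 hv) 2
  have hlt : ∑ j, Fintype.card ι * (a j * inner ℝ v (b j - b i)) < ∑ _j : ι, ‖v‖ ^ 2 :=
    Finset.sum_lt_sum (fun j _ => (eq_or_ne j i).elim (fun h => h ▸ hi₀.le) (hterm j))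
      ⟨i, Finset.mem_univ i, hi₀⟩
  rw [← Finset.mul_sum, hsum, Finset.sum_const, Finset.card_univ, nsmul_eq_mul] at hlt
  exact hlt.false

end AffineBases

section Simplices

variable {n : ℕ} {K : Geometry.SimplicialComplex ℝ (Amb n)} {s : Finset (Amb n)} {x z : Amb n}

lemma isCompact_simplex (s : Finset (Amb n)) : IsCompact (simplex s) :=
  s.finite_toSet.isCompact_convexHull (𝕜 := ℝ)

lemma isClosed_simplex (s : Finset (Amb n)) : IsClosed (simplex s) :=
  (isCompact_simplex s).isClosed

lemma convex_simplex (s : Finset (Amb n)) : Convex ℝ (simplex s) := convex_convexHull ℝ _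

lemma mem_simplex_of_mem (hx : x ∈ s) : x ∈ simplex s := subset_convexHull ℝ _ (Finset.mem_coe.2 hx)

lemma norm_sub_le_diam_simplex (hx : x ∈ simplex s) (hz : z ∈ simplex s) :
    ‖z - x‖ ≤ Metric.diam (simplex s) :=
  (dist_eq_norm z x).symm.trans_le
    (Metric.dist_le_diam_of_mem (isCompact_simplex s).isBounded hz hx)

/-- The vertices of a cell as an affine basis, whose coordinates are the barycentric ones. -/
noncomputable def vertexBasis (hs : s ∈ cells K) : AffineBasis s ℝ (Amb n) :=
  ⟨(↑), K.indep hs.1, by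
    rw [(K.indep hs.1).affineSpan_eq_top_iff_card_eq_finrank_add_one]
    simp [hs.2]⟩

lemma convexHull_range_vertexBasis (hs : s ∈ cells K) :
    convexHull ℝ (range (vertexBasis hs)) = simplex s :=
  congrArg (convexHull ℝ) Subtype.range_coe

lemma interior_simplex_nonempty (hs : s ∈ cells K) : (interior (simplex s)).Nonempty :=
  convexHull_range_vertexBasis hs ▸ ⟨_, (vertexBasis hs).centroid_mem_interior_convexHull⟩

lemma simplex_subset_closure_interior (hs : s ∈ cells K) :
    simplex s ⊆ closure (interior (simplex s)) := by
  rw [(convex_simplex s).closure_interior_eq_closure_of_nonempty_interior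
    (interior_simplex_nonempty hs)]
  exact subset_closure

lemma interior_simplex_inter_nonempty {U : Set (Amb n)} (hs : s ∈ cells K) (hU : IsOpen U)
    (h : (simplex s ∩ U).Nonempty) : (interior (simplex s) ∩ U).Nonempty := by
  obtain ⟨y, hy, hyU⟩ := h
  rw [inter_comm]
  exact mem_closure_iff.1 (simplex_subset_closure_interior hs hy) U hU hyU

lemma diam_simplex_pos (hs : s ∈ cells K) : 0 < Metric.diam (simplex s) := by
  obtain ⟨x, hx, y, hy, hxy⟩ := Finset.one_lt_card.1 (by rw [hs.2]; lia : 1 < s.card)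
  exact (norm_pos_iff.2 (sub_ne_zero.2 hxy)).trans_le
    (norm_sub_le_diam_simplex (mem_simplex_of_mem hy) (mem_simplex_of_mem hx))

lemma exists_vertex_mul_norm_le_inner_sub (hs : s ∈ cells K) {σ : ℝ} (hσ : 0 < σ)
    (hreg : σ * Metric.diam (simplex s) ≤ inradius (simplex s)) (hx : x ∈ s) {v : Amb n}
    (hv : v ≠ 0) (hxv : x + v ∈ simplex s) :
    ∃ z ∈ s, σ / (2 * (n + 2)) * Metric.diam (simplex s) * ‖v‖ ≤ inner ℝ v (z - x) := by
  have hD := diam_simplex_pos hs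
  obtain ⟨q, ⟨hq₀, c, hball⟩, hq⟩ := exists_lt_of_lt_csSup
    (s := {r | 0 ≤ r ∧ ∃ c, Metric.closedBall c r ⊆ simplex s})
    ⟨0, le_rfl, x, by simpa using mem_simplex_of_mem hx⟩
    ((half_lt_self (mul_pos hσ hD)).trans_le hreg)
  rw [← convexHull_range_vertexBasis hs] at hball hxv
  obtain ⟨z, hz⟩ := exists_mul_norm_le_card_mul_inner_sub (vertexBasis hs) hq₀ hball hv
    (i := ⟨x, hx⟩) hxv
  refine ⟨z, z.2, ?_⟩
  rw [Fintype.card_coe, hs.2] at hz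
  push_cast at hz
  calc σ / (2 * (n + 2)) * Metric.diam (simplex s) * ‖v‖
      = σ * Metric.diam (simplex s) / 2 * ‖v‖ / (n + 2) := by field_simp
    _ ≤ inner ℝ v ((z : Amb n) - x) := by
        rw [div_le_iff₀' (by positivity)]
        exact (mul_le_mul_of_nonneg_right hq.le (norm_nonneg v)).trans hz

end Simplices

section Complex

variable {n : ℕ} {Ω : Set (Amb n)} {K : Geometry.SimplicialComplex ℝ (Amb n)}
  {s : Finset (Amb n)} {x : Amb n}

lemma mem_vertices_of_mem_cell (hs : s ∈ cells K) (hx : x ∈ s) : x ∈ K.vertices :=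
  K.down_closed hs.1 (Finset.singleton_subset_iff.2 hx) (Finset.singleton_nonempty x)

namespace IsTriangulation

variable (hK : IsTriangulation Ω K)
include hK

lemma finite_cells : (cells K).Finite := hK.finite.subset fun _ hs => hs.1

lemma finite_vertices : K.vertices.Finite := by
  rw [K.vertices_eq]
  exact hK.finite.biUnion fun s _ => s.finite_toSet

lemma simplex_subset (hs : s ∈ cells K) : simplex s ⊆ closure Ω :=
  hK.space_eq ▸ K.convexHull_subset_space hs.1

lemma exists_mem_simplex (hx : x ∈ Ω) : ∃ s ∈ cells K, x ∈ simplex s := by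
  obtain ⟨r, hr, hxr⟩ := K.mem_space_iff.1 (hK.space_eq ▸ subset_closure hx)
  obtain ⟨s, hs, hrs⟩ := hK.pure r hr
  exact ⟨s, hs, convexHull_mono (Finset.coe_subset.2 hrs) hxr⟩

lemma diam_le_meshSize (hs : s ∈ cells K) : Metric.diam (simplex s) ≤ meshSize K :=
  le_csSup (hK.finite_cells.image _).bddAbove ⟨s, hs, rfl⟩

lemma eventually_exists_cell (hΩ : IsOpen Ω) (hx : x ∈ K.vertices) (hxΩ : x ∈ Ω) :
    ∀ᶠ y in 𝓝 x, ∃ s ∈ cells K, x ∈ s ∧ y ∈ simplex s := by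
  have hclosed : IsClosed (⋃ s ∈ {s ∈ cells K | x ∉ s}, simplex s) :=
    (hK.finite_cells.subset (sep_subset _ _)).isClosed_biUnion fun s _ => isClosed_simplex s
  have hxnot : x ∉ ⋃ s ∈ {s ∈ cells K | x ∉ s}, simplex s := by
    simp only [mem_iUnion, not_exists]
    exact fun s hs hxs => hs.2 ((K.vertex_mem_convexHull_iff hx hs.1.1).1 hxs)
  filter_upwards [hΩ.mem_nhds hxΩ, hclosed.isOpen_compl.mem_nhds hxnot] with y hyΩ hy
  obtain ⟨s, hs, hys⟩ := hK.exists_mem_simplex hyΩ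
  exact ⟨s, hs, by_contra fun hxs => hy (mem_biUnion (x := s) ⟨hs, hxs⟩ hys), hys⟩

lemma exists_cell_add_smul_mem (hΩ : IsOpen Ω) (hx : x ∈ K.vertices) (hxΩ : x ∈ Ω) (d : Amb n) :
    ∃ s ∈ cells K, x ∈ s ∧ ∃ r : ℝ, 0 < r ∧ x + r • d ∈ simplex s := by
  have hlim : Tendsto (fun r : ℝ => x + r • d) (𝓝[>] 0) (𝓝 x) :=
    ((by fun_prop : Continuous fun r : ℝ => x + r • d).tendsto' 0 x (by simp)).mono_left
      nhdsWithin_le_nhds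
  obtain ⟨r, ⟨s, hs, hxs, hrs⟩, hr⟩ := ((hlim.eventually
    (hK.eventually_exists_cell hΩ hx hxΩ)).and self_mem_nhdsWithin).exists
  exact ⟨s, hs, hxs, r, hr, hrs⟩

end IsTriangulation

end Complex

section Gradients

variable {E : Type*} [NormedAddCommGroup E] [InnerProductSpace ℝ E] [CompleteSpace E]
  {u v : E → ℝ} {g x : E}

lemma gradient_add_of_differentiableAt (hu : DifferentiableAt ℝ u x)
    (hv : DifferentiableAt ℝ v x) : gradient (u + v) x = gradient u x + gradient v x := by
  rw [gradient, fderiv_add hu hv, map_add, gradient, gradient]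

lemma gradient_const_smul_of_differentiableAt (hu : DifferentiableAt ℝ u x) (c : ℝ) :
    gradient (c • u) x = c • gradient u x := by
  rw [gradient, fderiv_const_smul hu, map_smul, gradient]

lemma measurable_gradient [MeasurableSpace E] [BorelSpace E] (u : E → ℝ) :
    Measurable (gradient u) :=
  (InnerProductSpace.toDual ℝ E).symm.continuous.measurable.comp (measurable_fderiv ℝ u)

lemma hasGradientAt_of_eqOn_inner_add_const {A : Set E} {c : ℝ}
    (h : EqOn u (fun y => inner ℝ g y + c) A) (hx : x ∈ interior A) : HasGradientAt u g x := by
  have haffine : HasGradientAt (fun y => inner ℝ g y + c) g x :=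
    (innerSL ℝ g).hasFDerivAt.add_const c
  exact haffine.congr_of_eventuallyEq (h.eventuallyEq_of_mem (mem_interior_iff_mem_nhds.1 hx))

lemma exists_inner_add_const_eq_affineMap [FiniteDimensional ℝ E] (A : E →ᵃ[ℝ] ℝ) :
    ∃ (g : E) (c : ℝ), ∀ x, A x = inner ℝ g x + c := by
  refine ⟨(InnerProductSpace.toDual ℝ E).symm A.linear.toContinuousLinearMap, A 0, fun x => ?_⟩
  rw [InnerProductSpace.toDual_symm_apply]
  exact congrFun A.decomp x

end Gradients

section PiecewiseAffine

variable {n : ℕ} {K : Geometry.SimplicialComplex ℝ (Amb n)} {C : Set (Finset (Amb n))}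
  {s : Finset (Amb n)} {x : Amb n} {u v : Amb n → ℝ}

/-- The union of a set of simplices. -/
def region (C : Set (Finset (Amb n))) : Set (Amb n) := ⋃ s ∈ C, simplex s

/-- The continuous functions on the union of a set `C` of simplices that are affine on each of them,
extended by zero. For the active simplices this is the finite element space. -/
def piecewiseAffine (C : Set (Finset (Amb n))) : Submodule ℝ (Amb n → ℝ) where
  carrier := {v | ContinuousOn v (region C) ∧
    (∀ s ∈ C, ∃ A : Amb n →ᵃ[ℝ] ℝ, EqOn v A (simplex s)) ∧ ∀ x ∉ region C, v x = 0}
  add_mem' := by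
    rintro u v ⟨hu, huA, hu₀⟩ ⟨hv, hvA, hv₀⟩
    refine ⟨hu.add hv, fun s hs => ?_, fun x hx => by simp [hu₀ x hx, hv₀ x hx]⟩
    obtain ⟨A, hA⟩ := huA s hs
    obtain ⟨B, hB⟩ := hvA s hs
    exact ⟨A + B, fun x hx => by simp [hA hx, hB hx]⟩
  zero_mem' := ⟨continuousOn_const, fun s _ => ⟨0, fun x _ => by simp⟩, fun _ _ => rfl⟩
  smul_mem' := by
    rintro c u ⟨hu, huA, hu₀⟩
    refine ⟨hu.const_smul c, fun s hs => ?_, fun x hx => by simp [hu₀ x hx]⟩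
    obtain ⟨A, hA⟩ := huA s hs
    exact ⟨c • A, fun x hx => by simp [hA hx]⟩

lemma simplex_subset_region (hs : s ∈ C) : simplex s ⊆ region C :=
  subset_biUnion_of_mem (u := fun s => simplex s) hs

lemma mem_region : x ∈ region C ↔ ∃ s ∈ C, x ∈ simplex s := by
  simp only [region, mem_iUnion, exists_prop]

lemma isCompact_region (hC : C.Finite) : IsCompact (region C) :=
  hC.isCompact_biUnion fun s _ => isCompact_simplex s

lemma exists_piecewiseAffine_eqOn (hC : C.Finite) {A : Finset (Amb n) → Amb n →ᵃ[ℝ] ℝ}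
    (hA : ∀ s ∈ C, ∀ r ∈ C, EqOn (A s) (A r) (simplex s ∩ simplex r)) :
    ∃ w ∈ piecewiseAffine C, ∀ s ∈ C, EqOn w (A s) (simplex s) := by
  classical
  let w : Amb n → ℝ := fun x => if h : ∃ s ∈ C, x ∈ simplex s then A h.choose x else 0
  have hw : ∀ s ∈ C, EqOn w (A s) (simplex s) := fun s hs x hx => by
    have h : ∃ s ∈ C, x ∈ simplex s := ⟨s, hs, hx⟩
    simp only [w, dif_pos h]
    exact hA _ h.choose_spec.1 s hs ⟨h.choose_spec.2, hx⟩
  have hcont : ContinuousOn w (region C) := by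
    have : Finite C := hC
    rw [region, biUnion_eq_iUnion]
    exact (locallyFinite_of_finite _).continuousOn_iUnion (fun s => isClosed_simplex s.1)
      fun s => (A s.1).continuous_of_finiteDimensional.continuousOn.congr (hw s.1 s.2)
  exact ⟨w, ⟨hcont, fun s hs => ⟨A s, hw s hs⟩, fun x hx => dif_neg (mt mem_region.2 hx)⟩, hw⟩

lemma exists_piecewiseAffine_eq_on_vertices (hCK : C ⊆ cells K) (hC : C.Finite) (f : Amb n → ℝ) :
    ∃ w ∈ piecewiseAffine C, ∀ s ∈ C, ∀ x ∈ s, w x = f x := by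
  have hA : ∀ s ∈ C, ∃ A : Amb n →ᵃ[ℝ] ℝ, ∀ x ∈ s, A x = f x := fun s hs => by
    obtain ⟨A, hA⟩ := exists_affineMap_eq_on_affineBasis (vertexBasis (hCK hs)) fun i => f i
    exact ⟨A, fun x hx => hA ⟨x, hx⟩⟩
  choose! A hA using hA
  have hcompat : ∀ s ∈ C, ∀ r ∈ C, EqOn (A s) (A r) (simplex s ∩ simplex r) := by
    intro s hs r hr x hx
    exact AffineMap.eqOn_affineSpan (fun y hy => (hA s hs y hy.1).trans (hA r hr y hy.2).symm)
      (convexHull_subset_affineSpan _ (K.inter_subset_convexHull (hCK hs).1 (hCK hr).1 hx))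
  obtain ⟨w, hw, hwA⟩ := exists_piecewiseAffine_eqOn hC hcompat
  exact ⟨w, hw, fun s hs x hx => (hwA s hs (mem_simplex_of_mem hx)).trans (hA s hs x hx)⟩

namespace piecewiseAffine

lemma exists_eqOn_inner_add_const (hu : u ∈ piecewiseAffine C) (hs : s ∈ C) :
    ∃ (g : Amb n) (c : ℝ), EqOn u (fun x => inner ℝ g x + c) (simplex s) := by
  obtain ⟨A, hA⟩ := hu.2.1 s hs
  obtain ⟨g, c, hg⟩ := exists_inner_add_const_eq_affineMap A
  exact ⟨g, c, fun x hx => (hA hx).trans (hg x)⟩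

lemma ext_vertices (hu : u ∈ piecewiseAffine C) (hv : v ∈ piecewiseAffine C)
    (h : ∀ s ∈ C, ∀ x ∈ s, u x = v x) : u = v := by
  funext x
  by_cases hx : x ∈ region C
  · obtain ⟨s, hs, hxs⟩ := mem_region.1 hx
    obtain ⟨A, hA⟩ := hu.2.1 s hs
    obtain ⟨B, hB⟩ := hv.2.1 s hs
    rw [hA hxs, hB hxs]
    refine AffineMap.eqOn_affineSpan (fun y hy => ?_) (convexHull_subset_affineSpan _ hxs)
    rw [← hA (mem_simplex_of_mem hy), ← hB (mem_simplex_of_mem hy), h s hs y hy]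
  · rw [hu.2.2 x hx, hv.2.2 x hx]

lemma finiteDimensional (hC : C.Finite) : FiniteDimensional ℝ (piecewiseAffine C) := by
  have : Finite (⋃ s ∈ C, (s : Set (Amb n)) : Set (Amb n)) :=
    hC.biUnion fun s _ => s.finite_toSet
  refine FiniteDimensional.of_injective
    ((LinearMap.funLeft ℝ ℝ ((↑) : (⋃ s ∈ C, (s : Set (Amb n)) : Set (Amb n)) → Amb n)).comp
      (piecewiseAffine C).subtype)
    fun u v huv => Subtype.ext (ext_vertices u.2 v.2 fun s hs x hx => ?_)
  exact congrFun huv ⟨x, mem_biUnion hs hx⟩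

lemma nonneg (hu : u ∈ piecewiseAffine C) (h : ∀ s ∈ C, ∀ x ∈ s, 0 ≤ u x) (x : Amb n) :
    0 ≤ u x := by
  by_cases hx : x ∈ region C
  · obtain ⟨s, hs, hxs⟩ := mem_region.1 hx
    obtain ⟨A, hA⟩ := hu.2.1 s hs
    have hsub : simplex s ⊆ A ⁻¹' Ici 0 := convexHull_min
      (fun y hy => (h s hs y hy).trans_eq (hA (mem_simplex_of_mem hy)))
      ((convex_Ici 0).affine_preimage A)
    exact (hsub hxs).trans_eq (hA hxs).symm
  · exact (hu.2.2 x hx).ge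

section Integrability

variable (hC : C.Finite) (hu : u ∈ piecewiseAffine C)
include hC hu

lemma measurable : Measurable u := by
  classical
  have hpiecewise : u = (region C).piecewise u 0 := by
    funext x
    by_cases hx : x ∈ region C
    · rw [piecewise_eq_of_mem _ _ _ hx]
    · rw [piecewise_eq_of_notMem _ _ _ hx, hu.2.2 x hx, Pi.zero_apply]
  rw [hpiecewise]
  exact hu.1.measurable_piecewise continuousOn_const (isCompact_region hC).measurableSet

lemma exists_bound : ∃ M : ℝ, ∀ x, ‖u x‖ ≤ M := by
  obtain ⟨M, hM⟩ := (isCompact_region hC).exists_bound_of_continuousOn hu.1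
  refine ⟨max M 0, fun x => ?_⟩
  by_cases hx : x ∈ region C
  · exact (hM x hx).trans (le_max_left _ _)
  · rw [hu.2.2 x hx, norm_zero]
    exact le_max_right _ _

lemma hasGradientAt_zero (hx : x ∉ region C) : HasGradientAt u 0 x :=
  (hasGradientAt_const x 0).congr_of_eventuallyEq <| by
    filter_upwards [(isCompact_region hC).isClosed.isOpen_compl.mem_nhds hx] with y hy
      using hu.2.2 y hy

lemma exists_finite_ae_hasGradientAt :
    ∃ G : Set (Amb n), G.Finite ∧ ∀ᵐ x : Amb n, ∃ g ∈ G, HasGradientAt u g x := by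
  choose! g c hg using fun s (hs : s ∈ C) => exists_eqOn_inner_add_const hu hs
  have hfrontier : ∀ᵐ x : Amb n, ∀ s ∈ C, x ∉ frontier (simplex s) :=
    (ae_ball_iff hC.countable).2 fun s _ =>
      measure_eq_zero_iff_ae_notMem.1 ((convex_simplex s).addHaar_frontier volume)
  refine ⟨insert 0 (g '' C), (hC.image g).insert 0, ?_⟩
  filter_upwards [hfrontier] with x hx
  by_cases hxC : x ∈ region C
  · obtain ⟨s, hs, hxs⟩ := mem_region.1 hxC
    have hinterior : x ∈ interior (simplex s) := by
      by_contra hnot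
      exact hx s hs ⟨subset_closure hxs, hnot⟩
    exact ⟨g s, mem_insert_of_mem 0 (mem_image_of_mem g hs),
      hasGradientAt_of_eqOn_inner_add_const (hg s hs) hinterior⟩
  · exact ⟨0, mem_insert 0 _, hasGradientAt_zero hC hu hxC⟩

lemma ae_differentiableAt : ∀ᵐ x : Amb n, DifferentiableAt ℝ u x := by
  obtain ⟨G, -, hG⟩ := exists_finite_ae_hasGradientAt hC hu
  filter_upwards [hG] with x ⟨g, _, hg⟩ using hg.differentiableAt

lemma exists_ae_norm_gradient_le : ∃ M : ℝ, ∀ᵐ x : Amb n, ‖gradient u x‖ ≤ M := by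
  obtain ⟨G, hGfin, hG⟩ := exists_finite_ae_hasGradientAt hC hu
  obtain ⟨M, hM⟩ := hGfin.isBounded.exists_norm_le
  exact ⟨M, by filter_upwards [hG] with x ⟨g, hgG, hg⟩ using hg.gradient ▸ hM g hgG⟩

end Integrability

open scoped ENNReal

lemma isLinftyLinear_coe (hC : C.Finite) (μ : Measure (Amb n)) :
    IsLinftyLinear μ fun (u : piecewiseAffine C) x => (u : Amb n → ℝ) x where
  map_add _ _ := .rfl
  map_smul _ _ := .rfl
  memLp u := by
    obtain ⟨M, hM⟩ := exists_bound hC u.2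
    exact memLp_top_of_bound (measurable hC u.2).aestronglyMeasurable M (.of_forall hM)

lemma isLinftyLinear_gradient (hC : C.Finite) (A : Set (Amb n)) :
    IsLinftyLinear (volume.restrict A) fun (u : piecewiseAffine C) x => gradient u.1 x where
  map_add u v := by
    filter_upwards [ae_restrict_of_ae (ae_differentiableAt hC u.2),
      ae_restrict_of_ae (ae_differentiableAt hC v.2)] with x hu hv
      using gradient_add_of_differentiableAt hu hv
  map_smul c u := by
    filter_upwards [ae_restrict_of_ae (ae_differentiableAt hC u.2)] with x hu
      using gradient_const_smul_of_differentiableAt hu c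
  memLp u := by
    obtain ⟨M, hM⟩ := exists_ae_norm_gradient_le hC u.2
    exact memLp_top_of_bound (measurable_gradient _).aestronglyMeasurable M (ae_restrict_of_ae hM)

end piecewiseAffine

end PiecewiseAffine

lemma profile_nonneg (r : ℝ) : 0 ≤ profile r := by
  unfold profile
  split_ifs
  exacts [sq_nonneg _, le_rfl]

lemma profile_le_one (r : ℝ) : profile r ≤ 1 := by
  unfold profile
  split_ifs
  exacts [Real.cos_sq_le_one r, zero_le_one]

lemma cos_eq_zero_of_abs_eq_pi_div_two {r : ℝ} (hr : |r| = Real.pi / 2) : Real.cos r = 0 := by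
  rw [← Real.cos_abs, hr, Real.cos_pi_div_two]

lemma profile_pos_iff {r : ℝ} : 0 < profile r ↔ |r| < Real.pi / 2 := by
  refine ⟨fun hpos => ?_, fun hr => ?_⟩
  · by_contra! hr
    rcases hr.eq_or_lt with heq | hlt
    · simp [profile, cos_eq_zero_of_abs_eq_pi_div_two heq.symm] at hpos
    · simp [profile, not_le.2 hlt] at hpos
  · rw [profile, if_pos hr.le]
    exact pow_pos (Real.cos_pos_of_mem_Ioo (abs_lt.1 hr)) 2

lemma continuous_profile : Continuous profile :=
  Continuous.if_le (by fun_prop) continuous_const (by fun_prop) continuous_const fun r hr => by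
    rw [cos_eq_zero_of_abs_eq_pi_div_two hr, zero_pow two_ne_zero]

namespace MovingSurface

open scoped ENNReal

variable {n : ℕ} (S : MovingSurface n) {ε t δ : ℝ} {x : Amb n}

lemma phase_nonneg (ε : ℝ) (x : Amb n) (t : ℝ) : 0 ≤ S.phase ε x t :=
  indicator_nonneg (fun _ _ => profile_nonneg _) _

lemma phase_le_one (ε : ℝ) (x : Amb n) (t : ℝ) : S.phase ε x t ≤ 1 :=
  indicator_le' (fun _ _ => profile_le_one _) (fun _ _ => zero_le_one) _

lemma phase_pos_iff (hε : 0 < ε) : 0 < S.phase ε x t ↔ x ∈ S.band (ε * Real.pi / 2) t := by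
  have hprofile : 0 < profile (S.φ x t / ε) ↔ |S.φ x t| < ε * Real.pi / 2 := by
    rw [profile_pos_iff, abs_div, abs_of_pos hε, div_lt_iff₀ hε, div_mul_comm, mul_div_right_comm]
  by_cases hx : x ∈ S.Ω
  · rw [phase, indicator_of_mem hx, hprofile]
    exact ⟨fun h => ⟨hx, h⟩, fun h => h.2⟩
  · rw [phase, indicator_of_notMem hx]
    exact ⟨fun h => absurd h (lt_irrefl 0), fun h => absurd h.1 hx⟩

lemma phase_eq_zero (hε : 0 < ε) (hx : x ∉ S.band (ε * Real.pi / 2) t) : S.phase ε x t = 0 :=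
  (not_lt.1 (mt (S.phase_pos_iff hε).1 hx)).antisymm (S.phase_nonneg ε x t)

lemma phase_two_mul_pos_iff (hε : 0 < ε) :
    0 < S.phase (2 * ε) x t ↔ x ∈ S.band (ε * Real.pi) t := by
  rw [S.phase_pos_iff (by positivity), mul_assoc, mul_div_cancel_left₀ _ two_ne_zero]

lemma weight_nonneg (ε : ℝ) (x : Amb n) (t : ℝ) : 0 ≤ S.weight ε x t :=
  mul_nonneg (S.phase_nonneg ε x t) (norm_nonneg _)

lemma weight_eq_zero (hε : 0 < ε) (hx : x ∉ S.band (ε * Real.pi / 2) t) : S.weight ε x t = 0 := by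
  rw [weight, S.phase_eq_zero hε hx, zero_mul]

lemma weight_pos (ht : t ∈ Icc 0 S.T) (hε : 0 < ε) (hεδ : ε * Real.pi / 2 ≤ S.δ₀)
    (hx : x ∈ S.band (ε * Real.pi / 2) t) : 0 < S.weight ε x t :=
  mul_pos ((S.phase_pos_iff hε).2 hx)
    (norm_pos_iff.2 (S.gradAt_ne_zero ht (S.band_mono hεδ t hx)))

lemma norm_weight_le (ht : t ∈ Icc 0 S.T) (hε : 0 < ε) (hεδ : ε * Real.pi / 2 ≤ S.δ₀)
    (x : Amb n) : ‖S.weight ε x t‖ ≤ S.c₁ := by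
  by_cases hx : x ∈ S.band (ε * Real.pi / 2) t
  · rw [Real.norm_of_nonneg (S.weight_nonneg ε x t), weight]
    exact (mul_le_of_le_one_left (norm_nonneg _) (S.phase_le_one ε x t)).trans
      (S.grad_upper t ht x (S.band_mono hεδ t hx))
  · rw [S.weight_eq_zero hε hx, norm_zero]
    exact S.c₁_nonneg

lemma aestronglyMeasurable_weight (ht : t ∈ Icc 0 S.T) :
    AEStronglyMeasurable (fun x => S.weight ε x t) (volume.restrict S.Ω) := by
  have hphase : ContinuousOn (fun x => S.phase ε x t) S.Ω :=
    (continuous_profile.comp_continuousOn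
      ((S.contDiffOn_slice ht).continuousOn.div_const ε)).congr fun x hx => by
        rw [phase, indicator_of_mem hx, Function.comp_apply]
  exact (hphase.mul (S.contDiffOn_gradAt ht).continuousOn.norm).aestronglyMeasurable
    S.isOpen_Ω.measurableSet

lemma memLp_top_weight (ht : t ∈ Icc 0 S.T) (hε : 0 < ε) (hεδ : ε * Real.pi / 2 ≤ S.δ₀) :
    MemLp (fun x => S.weight ε x t) ∞ (volume.restrict S.Ω) :=
  memLp_top_of_bound (S.aestronglyMeasurable_weight ht) S.c₁
    (.of_forall (S.norm_weight_le ht hε hεδ))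

lemma memLp_top_weight_smul {E : Type*} [NormedAddCommGroup E] [NormedSpace ℝ E]
    [SecondCountableTopology E] {b : Amb n → E} {C : ℝ} (ht : t ∈ Icc 0 S.T) (hε : 0 < ε)
    (hεδ : ε * Real.pi / 2 ≤ δ) (hδ : δ ≤ S.δ₀) (hb : ContinuousOn b (S.band δ t))
    (hC : ∀ x ∈ S.band δ t, ‖b x‖ ≤ C) :
    MemLp (fun x => S.weight ε x t • b x) ∞ (volume.restrict S.Ω) := by
  have hmeas : MeasurableSet (S.band δ t) := (S.isOpen_band ht δ).measurableSet
  have hcutoff : (fun x => S.weight ε x t • b x) =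
      fun x => S.weight ε x t • (S.band δ t).indicator b x := by
    funext x
    by_cases hx : x ∈ S.band δ t
    · rw [indicator_of_mem hx]
    · rw [S.weight_eq_zero hε (mt (fun h => S.band_mono hεδ t h) hx), zero_smul, zero_smul]
  have hindicator : MemLp ((S.band δ t).indicator b) ∞ volume :=
    (memLp_indicator_iff_restrict hmeas).2 (memLp_top_of_bound (hb.aestronglyMeasurable hmeas) C
      (ae_restrict_of_forall_mem hmeas hC))
  rw [hcutoff]
  exact hindicator.restrict S.Ω |>.smul (S.memLp_top_weight ht hε (hεδ.trans hδ))

lemma isFiniteMeasure_restrict_Ω : IsFiniteMeasure (volume.restrict S.Ω) :=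
  isFiniteMeasure_restrict.2 S.isBounded_Ω.measure_lt_top.ne

lemma integrable_ext {f : Amb n → ℝ → ℝ}
    (hf : IntegrableOn (fun x => S.ext δ f x t) (S.band δ t)) :
    Integrable (fun x => S.ext δ f x t) :=
  (integrableOn_iff_integrable_of_support_subset fun x hx => by
    by_contra hxband
    exact hx (if_neg hxband)).1 hf

end MovingSurface

namespace MovingSurface

variable {n : ℕ} (S : MovingSurface n) {K : Geometry.SimplicialComplex ℝ (Amb n)} {ε t : ℝ}
  {s : Finset (Amb n)} {x : Amb n}

lemma activeCells_subset : S.activeCells K ε t ⊆ cells K := fun _ hs => hs.1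

lemma finite_activeCells (hK : IsTriangulation S.Ω K) : (S.activeCells K ε t).Finite :=
  hK.finite_cells.subset S.activeCells_subset

lemma mem_activeCells_of_mem_band (hε : 0 < ε) (hs : s ∈ cells K) (hx : x ∈ s)
    (hxε : x ∈ S.band (ε * Real.pi) t) : s ∈ S.activeCells K ε t :=
  ⟨hs, x, hx, (S.phase_two_mul_pos_iff hε).2 hxε⟩

lemma exists_mem_band_of_mem_activeCells (hε : 0 < ε) (hs : s ∈ S.activeCells K ε t) :
    ∃ x ∈ s, x ∈ S.band (ε * Real.pi) t :=
  let ⟨x, hx, hpos⟩ := hs.2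
  ⟨x, hx, (S.phase_two_mul_pos_iff hε).1 hpos⟩

lemma interp_spec (hK : IsTriangulation S.Ω K) (ε t : ℝ) (f : Amb n → ℝ) :
    S.interp K ε t f ∈ piecewiseAffine (S.activeCells K ε t) ∧
      ∀ s ∈ S.activeCells K ε t, ∀ x ∈ s, S.interp K ε t f x = f x := by
  obtain ⟨w, hw, hwf⟩ := exists_piecewiseAffine_eq_on_vertices S.activeCells_subset
    (S.finite_activeCells (ε := ε) (t := t) hK) f
  have hvertices : ∀ x ∈ S.discreteBand K ε t ∩ K.vertices, w x = f x := fun x hx => by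
    obtain ⟨s, hs, hxs⟩ := mem_region.1 hx.1
    exact hwf s hs x ((K.vertex_mem_convexHull_iff hx.2 hs.1.1).1 hxs)
  have hspec := Classical.epsilon_spec (p := fun w => w ∈ S.feSpace K ε t ∧
    ∀ x ∈ S.discreteBand K ε t ∩ K.vertices, w x = f x) ⟨w, hw, hvertices⟩
  exact ⟨hspec.1, fun s hs x hx => hspec.2 x
    ⟨simplex_subset_region hs (mem_simplex_of_mem hx), mem_vertices_of_mem_cell hs.1 hx⟩⟩

lemma interp_phase_nonneg (hK : IsTriangulation S.Ω K) (x : Amb n) :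
    0 ≤ S.interp K ε t (fun y => S.phase (2 * ε) y t) x := by
  obtain ⟨hmem, heq⟩ := S.interp_spec hK ε t fun y => S.phase (2 * ε) y t
  exact piecewiseAffine.nonneg hmem
    (fun s hs y hy => (S.phase_nonneg _ _ _).trans_eq (heq s hs y hy).symm) x

lemma exists_isOpen_interp_phase_pos (hK : IsTriangulation S.Ω K)
    (hs : s ∈ S.activeCells K ε t) :
    ∃ U, IsOpen U ∧ (simplex s ∩ U).Nonempty ∧
      ∀ x ∈ simplex s ∩ U, 0 < S.interp K ε t (fun y => S.phase (2 * ε) y t) x := by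
  obtain ⟨hmem, heq⟩ := S.interp_spec hK ε t fun y => S.phase (2 * ε) y t
  obtain ⟨A, hA⟩ := hmem.2.1 s hs
  obtain ⟨y, hys, hy⟩ := hs.2
  have hAy : 0 < A y := by rwa [← hA (mem_simplex_of_mem hys), heq s hs y hys]
  exact ⟨{x | 0 < A x}, isOpen_lt continuous_const A.continuous_of_finiteDimensional,
    ⟨y, mem_simplex_of_mem hys, hAy⟩, fun x hx => hx.2.trans_eq (hA hx.1).symm⟩

end MovingSurface

namespace MovingSurface

variable {n : ℕ} {S : MovingSurface n} {K : Geometry.SimplicialComplex ℝ (Amb n)} {δ σ t : ℝ}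
  {s : Finset (Amb n)} {x : Amb n}

/-- Every vertex in the band `U_r(t)` belongs to a cell that either meets `Γ(t)` or has a vertex
at which `|φ|` is smaller. This is what the unique solvability of the scheme requires of the
mesh. -/
def HasVertexDescent (S : MovingSurface n) (K : Geometry.SimplicialComplex ℝ (Amb n))
    (r t : ℝ) : Prop :=
  ∀ x ∈ K.vertices, x ∈ S.band r t → ∃ s ∈ cells K, x ∈ s ∧
    ((simplex s ∩ S.surf t).Nonempty ∨ ∃ z ∈ s, z ∈ S.band |S.φ x t| t)

lemma simplex_subset_band (hK : IsTriangulation S.Ω K) (ht : t ∈ Icc 0 S.T)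
    (hmesh : δ + S.c₁ * meshSize K ≤ S.δ₀) (hs : s ∈ cells K) (hxs : x ∈ s)
    (hx : x ∈ S.band δ t) : simplex s ⊆ S.band S.δ₀ t := fun _ hy =>
  S.closedBall_subset_band ht hx hmesh <| mem_closedBall_iff_norm.2 <|
    (norm_sub_le_diam_simplex (mem_simplex_of_mem hxs) hy).trans (hK.diam_le_meshSize hs)

lemma mul_φ_lt_of_lt_inner (ht : t ∈ Icc 0 S.T) (hx : x ∈ S.band δ t) {z : Amb n} {θ : ℝ}
    (hθ : |θ| = 1) (hz : δ + S.c₁ * ‖z - x‖ ≤ S.δ₀)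
    (hslope : S.c₂ * ‖z - x‖ ^ 2 < -(θ * inner ℝ (gradAt S.φ x t) (z - x))) :
    θ * S.φ z t < θ * S.φ x t := by
  have htaylor := S.abs_sub_sub_inner_gradAt_le ht hx hz
  rw [← one_mul |_|, ← hθ, ← abs_mul] at htaylor
  linarith [le_of_abs_le htaylor]

/-- Follow `-θ∇φ` from `x` into a cell: some edge of the cell at `x` makes an angle with this
direction that is controlled by `σ`, and along an edge the Taylor remainder is of second order. -/
lemma exists_cell_exists_vertex_mul_φ_lt (hK : IsTriangulation S.Ω K) (hσ : 0 < σ)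
    (hreg : IsShapeRegular σ K) (ht : t ∈ Icc 0 S.T) (hmesh : δ + S.c₁ * meshSize K ≤ S.δ₀)
    (hmeshσ : S.c₂ * meshSize K < S.c₀ * (σ / (2 * (n + 2)))) (hx : x ∈ K.vertices)
    (hxδ : x ∈ S.band δ t) {θ : ℝ} (hθ : |θ| = 1) :
    ∃ s ∈ cells K, x ∈ s ∧ ∃ z ∈ s, θ * S.φ z t < θ * S.φ x t := by
  set g := gradAt S.φ x t
  obtain ⟨s, hs, hxs, r, hr, hxr⟩ := hK.exists_cell_add_smul_mem S.isOpen_Ω hx hxδ.1 (-θ • g)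
  have hxδ₀ : x ∈ S.band S.δ₀ t :=
    simplex_subset_band hK ht hmesh hs hxs hxδ (mem_simplex_of_mem hxs)
  have hθ₀ : θ ≠ 0 := abs_pos.1 (hθ ▸ one_pos)
  have hdir : r • -θ • g ≠ 0 :=
    smul_ne_zero hr.ne' (smul_ne_zero (neg_ne_zero.2 hθ₀) (S.gradAt_ne_zero ht hxδ₀))
  obtain ⟨z, hz, hedge⟩ := exists_vertex_mul_norm_le_inner_sub hs hσ (hreg s hs) hxs hdir hxr
  refine ⟨s, hs, hxs, z, hz, ?_⟩
  set D := Metric.diam (simplex s)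
  have hD : 0 < D := diam_simplex_pos hs
  have hzD : ‖z - x‖ ≤ D :=
    norm_sub_le_diam_simplex (mem_simplex_of_mem hxs) (mem_simplex_of_mem hz)
  have hDmesh : D ≤ meshSize K := hK.diam_le_meshSize hs
  have hslope : S.c₀ * (σ / (2 * (n + 2))) * D ≤ -(θ * inner ℝ g (z - x)) := by
    simp only [norm_smul, real_inner_smul_left, norm_neg, Real.norm_eq_abs, hθ, one_mul,
      abs_of_pos hr] at hedge
    have hscaled : r * (σ / (2 * (n + 2)) * D * ‖g‖) ≤ r * -(θ * inner ℝ g (z - x)) := by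
      linarith
    calc S.c₀ * (σ / (2 * (n + 2))) * D ≤ ‖g‖ * (σ / (2 * (n + 2))) * D := by
          gcongr
          exact S.grad_lower t ht x hxδ₀
      _ = σ / (2 * (n + 2)) * D * ‖g‖ := by ring
      _ ≤ -(θ * inner ℝ g (z - x)) := le_of_mul_le_mul_left hscaled hr
  have hremainder : S.c₂ * ‖z - x‖ ^ 2 ≤ S.c₂ * meshSize K * D := by
    rw [sq, mul_assoc]
    exact mul_le_mul_of_nonneg_left (mul_le_mul (hzD.trans hDmesh) hzD (norm_nonneg _)
      (hD.le.trans hDmesh)) S.c₂_pos.le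
  refine mul_φ_lt_of_lt_inner ht hxδ hθ ?_ ((hremainder.trans_lt ?_).trans_le hslope)
  · linarith [mul_le_mul_of_nonneg_left (hzD.trans hDmesh) S.c₁_nonneg]
  · exact mul_lt_mul_of_pos_right hmeshσ hD

lemma simplex_inter_surf_nonempty (ht : t ∈ Icc 0 S.T) (hsub : simplex s ⊆ S.Ω) {y z : Amb n}
    (hy : y ∈ simplex s) (hz : z ∈ simplex s) (hφy : S.φ y t ≤ 0) (hφz : 0 ≤ S.φ z t) :
    (simplex s ∩ S.surf t).Nonempty := by
  obtain ⟨w, hw, hw₀⟩ := (convex_simplex s).isPreconnected.intermediate_value hy hz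
    ((S.contDiffOn_slice ht).continuousOn.mono hsub) ⟨hφy, hφz⟩
  exact ⟨w, hw, hsub hw, hw₀⟩

theorem hasVertexDescent (hK : IsTriangulation S.Ω K) (hσ : 0 < σ) (hreg : IsShapeRegular σ K)
    (ht : t ∈ Icc 0 S.T) (hmesh : δ + S.c₁ * meshSize K ≤ S.δ₀)
    (hmeshσ : S.c₂ * meshSize K < S.c₀ * (σ / (2 * (n + 2)))) :
    S.HasVertexDescent K δ t := by
  intro x hx hxδ
  obtain ⟨θ, hθ, hθφ⟩ : ∃ θ : ℝ, |θ| = 1 ∧ θ * S.φ x t = |S.φ x t| := by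
    rcases le_total 0 (S.φ x t) with hφ | hφ
    · exact ⟨1, abs_one, by rw [one_mul, abs_of_nonneg hφ]⟩
    · exact ⟨-1, by rw [abs_neg, abs_one], by rw [neg_one_mul, abs_of_nonpos hφ]⟩
  obtain ⟨s, hs, hxs, z, hz, hlt⟩ :=
    exists_cell_exists_vertex_mul_φ_lt hK hσ hreg ht hmesh hmeshσ hx hxδ hθ
  have hsub : simplex s ⊆ S.Ω := fun y hy =>
    (simplex_subset_band hK ht hmesh hs hxs hxδ hy).1
  refine ⟨s, hs, hxs, ?_⟩
  by_cases hdesc : |S.φ z t| < |S.φ x t|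
  · exact .inr ⟨z, hz, hsub (mem_simplex_of_mem hz), hdesc⟩
  · have hsign : θ * S.φ z t ≤ 0 := by
      by_contra! hpos
      rw [hθφ, ← abs_of_pos hpos, abs_mul, hθ, one_mul] at hlt
      exact hdesc hlt
    left
    rcases (abs_eq zero_le_one).1 hθ with rfl | rfl
    · exact simplex_inter_surf_nonempty ht hsub (mem_simplex_of_mem hz) (mem_simplex_of_mem hxs)
        (by linarith) (by linarith [abs_nonneg (S.φ x t)])
    · exact simplex_inter_surf_nonempty ht hsub (mem_simplex_of_mem hxs) (mem_simplex_of_mem hz)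
        (by linarith [abs_nonneg (S.φ x t)]) (by linarith)

lemma exists_meshSize_bound (S : MovingSurface n) (hδ : δ < S.δ₀) (hσ : 0 < σ) :
    ∃ h₁ : ℝ, 0 < h₁ ∧ ∀ h ≤ h₁,
      δ + S.c₁ * h ≤ S.δ₀ ∧ S.c₂ * h < S.c₀ * (σ / (2 * (n + 2))) := by
  have hc₁ : 0 < S.c₁ := S.c₀_pos.trans_le S.c₀_le
  have hc₂ := S.c₂_pos
  have hκ : 0 < S.c₀ * (σ / (2 * (n + 2))) := mul_pos S.c₀_pos (by positivity)
  refine ⟨min ((S.δ₀ - δ) / S.c₁) (S.c₀ * (σ / (2 * (n + 2))) / 2 / S.c₂),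
    lt_min (div_pos (sub_pos.2 hδ) hc₁) (by positivity), fun h hh => ⟨?_, ?_⟩⟩
  · linarith [(le_div_iff₀' hc₁).1 (hh.trans (min_le_left _ _))]
  · linarith [(le_div_iff₀' hc₂).1 (hh.trans (min_le_right _ _))]

end MovingSurface

lemma IsTriangulation.exists_mem_interior_of_ae_restrict {n : ℕ} {Ω : Set (Amb n)}
    {K : Geometry.SimplicialComplex ℝ (Amb n)} (hK : IsTriangulation Ω K) (hΩ : IsOpen Ω)
    {s : Finset (Amb n)} (hs : s ∈ cells K) {U : Set (Amb n)} (hU : IsOpen U)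
    (hsU : (simplex s ∩ U).Nonempty) {p : Amb n → Prop} (hp : ∀ᵐ x ∂volume.restrict Ω, p x) :
    ∃ x ∈ interior (simplex s) ∩ U, p x := by
  obtain ⟨y, hys, hyU⟩ := interior_simplex_inter_nonempty hs hU hsU
  have hopen : IsOpen (interior (simplex s) ∩ U) := isOpen_interior.inter hU
  have hne : (interior (simplex s) ∩ U ∩ Ω).Nonempty :=
    mem_closure_iff.1 (hK.simplex_subset hs (interior_subset hys)) _ hopen ⟨hys, hyU⟩
  have : (ae (volume.restrict (interior (simplex s) ∩ U ∩ Ω))).NeBot :=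
    ae_restrict_neBot.2 ((hopen.inter hΩ).measure_ne_zero volume hne)
  obtain ⟨x, hpx, hx⟩ := ((ae_restrict_of_ae_restrict_of_subset inter_subset_right hp).and
    (ae_restrict_mem (hopen.inter hΩ).measurableSet)).exists
  exact ⟨x, hx.1, hpx⟩

namespace MovingSurface

variable {n : ℕ} {S : MovingSurface n} {K : Geometry.SimplicialComplex ℝ (Amb n)} {ε t : ℝ}
  {s : Finset (Amb n)} {u : Amb n → ℝ}

lemma exists_eqOn_const_of_ae_interp_phase_mul_eq_zero (hK : IsTriangulation S.Ω K)
    (hu : u ∈ piecewiseAffine (S.activeCells K ε t))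
    (hgrad : ∀ᵐ x ∂volume.restrict S.Ω,
      S.interp K ε t (fun y => S.phase (2 * ε) y t) x * ‖gradient u x‖ ^ 2 = 0)
    (hs : s ∈ S.activeCells K ε t) : ∃ c, EqOn u (fun _ => c) (simplex s) := by
  obtain ⟨g, c, hg⟩ := piecewiseAffine.exists_eqOn_inner_add_const hu hs
  obtain ⟨U, hU, hsU, hpos⟩ := S.exists_isOpen_interp_phase_pos hK hs
  obtain ⟨x, hx, hx₀⟩ := hK.exists_mem_interior_of_ae_restrict S.isOpen_Ω hs.1 hU hsU hgrad
  have hg₀ : g = 0 := by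
    rw [(hasGradientAt_of_eqOn_inner_add_const hg hx.1).gradient] at hx₀
    simpa using (mul_eq_zero.1 hx₀).resolve_left (hpos x ⟨interior_subset hx.1, hx.2⟩).ne'
  exact ⟨c, fun x hx => (hg hx).trans (by simp only [hg₀, inner_zero_left, zero_add])⟩

lemma exists_mem_simplex_eq_zero_of_ae_mul_weight_eq_zero (hK : IsTriangulation S.Ω K)
    (ht : t ∈ Icc 0 S.T) (hε : 0 < ε) (hεδ : ε * Real.pi / 2 ≤ S.δ₀)
    (hval : ∀ᵐ x ∂volume.restrict S.Ω, u x ^ 2 * S.weight ε x t = 0) (hs : s ∈ cells K)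
    (hsurf : (simplex s ∩ S.surf t).Nonempty) : ∃ x ∈ simplex s, u x = 0 := by
  obtain ⟨x, hx, hx₀⟩ := hK.exists_mem_interior_of_ae_restrict S.isOpen_Ω hs
    (S.isOpen_band ht (ε * Real.pi / 2))
    (hsurf.mono (inter_subset_inter_right _ (S.surf_subset_band (by positivity)))) hval
  have husq : u x ^ 2 = 0 :=
    (mul_eq_zero.1 hx₀).resolve_right (S.weight_pos ht hε hεδ hx.2).ne'
  exact ⟨x, interior_subset hx.1, pow_eq_zero_iff two_ne_zero |>.1 husq⟩

lemma eq_zero_of_mem_vertices_of_hasVertexDescent (hK : IsTriangulation S.Ω K) {r : ℝ}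
    (hdesc : S.HasVertexDescent K r t)
    (hconst : ∀ s ∈ cells K, (∃ x ∈ s, x ∈ S.band r t) → ∃ c, EqOn u (fun _ => c) (simplex s))
    (hsurf : ∀ s ∈ cells K, (simplex s ∩ S.surf t).Nonempty → ∃ x ∈ simplex s, u x = 0)
    {x : Amb n} (hx : x ∈ K.vertices) (hxr : x ∈ S.band r t) : u x = 0 := by
  by_contra hux
  set N : Set (Amb n) := {x | x ∈ K.vertices ∧ x ∈ S.band r t ∧ u x ≠ 0}
  obtain ⟨y, ⟨hy, hyr, huy⟩, hmin⟩ := exists_min_image N (fun x => |S.φ x t|)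
    (hK.finite_vertices.subset fun _ h => h.1) ⟨x, hx, hxr, hux⟩
  obtain ⟨s, hs, hys, hcase⟩ := hdesc y hy hyr
  obtain ⟨c, hc⟩ := hconst s hs ⟨y, hys, hyr⟩
  have hc₀ : c ≠ 0 := fun h => huy ((hc (mem_simplex_of_mem hys)).trans h)
  rcases hcase with hmeet | ⟨z, hz, hlt⟩
  · obtain ⟨w, hw, hw₀⟩ := hsurf s hs hmeet
    exact hc₀ ((hc hw).symm.trans hw₀)
  · refine (hmin z ⟨mem_vertices_of_mem_cell hs hz, S.band_mono hyr.2.le t hlt, ?_⟩).not_gt hlt.2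
    rwa [hc (mem_simplex_of_mem hz)]

theorem eq_zero_of_hasVertexDescent (hK : IsTriangulation S.Ω K) (ht : t ∈ Icc 0 S.T)
    (hε : 0 < ε) (hεδ : ε * Real.pi / 2 ≤ S.δ₀) (hdesc : S.HasVertexDescent K (ε * Real.pi) t)
    (hu : u ∈ piecewiseAffine (S.activeCells K ε t))
    (hval : ∀ᵐ x ∂volume.restrict S.Ω, u x ^ 2 * S.weight ε x t = 0)
    (hgrad : ∀ᵐ x ∂volume.restrict S.Ω,
      S.interp K ε t (fun y => S.phase (2 * ε) y t) x * ‖gradient u x‖ ^ 2 = 0) : u = 0 := by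
  have hconst : ∀ s ∈ S.activeCells K ε t, ∃ c, EqOn u (fun _ => c) (simplex s) := fun s hs =>
    exists_eqOn_const_of_ae_interp_phase_mul_eq_zero hK hu hgrad hs
  have hvertex : ∀ x ∈ K.vertices, x ∈ S.band (ε * Real.pi) t → u x = 0 := fun x hx hxε =>
    eq_zero_of_mem_vertices_of_hasVertexDescent hK hdesc
      (fun s hs ⟨y, hy, hyε⟩ => hconst s (S.mem_activeCells_of_mem_band hε hs hy hyε))
      (fun s hs hmeet =>
        exists_mem_simplex_eq_zero_of_ae_mul_weight_eq_zero hK ht hε hεδ hval hs hmeet) hx hxε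
  refine piecewiseAffine.ext_vertices hu (Submodule.zero_mem _) fun s hs x hx => ?_
  obtain ⟨c, hc⟩ := hconst s hs
  obtain ⟨z, hz, hzε⟩ := S.exists_mem_band_of_mem_activeCells hε hs
  rw [hc (mem_simplex_of_mem hx), ← hc (mem_simplex_of_mem hz),
    hvertex z (mem_vertices_of_mem_cell hs.1 hz) hzε, Pi.zero_apply]

end MovingSurface

namespace piecewiseAffine

open scoped ENNReal

variable {n : ℕ} {C : Set (Finset (Amb n))} {A : Set (Amb n)}
  [IsFiniteMeasure (volume.restrict A)] {a : Amb n → ℝ} {b : Amb n → Amb n}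

/-- The bilinear form `(u, v) ↦ ∫ u v a` on piecewise affine functions. -/
noncomputable def massForm (hC : C.Finite) (ha : MemLp a ∞ (volume.restrict A)) :
    piecewiseAffine C →ₗ[ℝ] piecewiseAffine C →ₗ[ℝ] ℝ :=
  (isLinftyLinear_coe hC _).form ((isLinftyLinear_coe hC _).smul_left ha)

lemma massForm_apply (hC : C.Finite) (ha : MemLp a ∞ (volume.restrict A))
    (u v : piecewiseAffine C) : massForm hC ha u v = ∫ x in A, u.1 x * v.1 x * a x := by
  rw [massForm, IsLinftyLinear.form_apply]
  exact integral_congr_ae (.of_forall fun x => by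
    simp only [RCLike.inner_apply, Real.ringHom_apply, smul_eq_mul]; ring)

lemma integrable_mul_mul (hC : C.Finite) (ha : MemLp a ∞ (volume.restrict A))
    (u v : piecewiseAffine C) :
    Integrable (fun x => u.1 x * v.1 x * a x) (volume.restrict A) :=
  ((isLinftyLinear_coe hC _).integrable_inner ((isLinftyLinear_coe hC _).smul_left ha) u v).congr
    (.of_forall fun x => by
      simp only [RCLike.inner_apply, Real.ringHom_apply, smul_eq_mul]; ring)

/-- The bilinear form `(u, v) ↦ ∫ ⟪∇u, ∇v⟫ a` on piecewise affine functions. -/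
noncomputable def stiffnessForm (hC : C.Finite) (ha : MemLp a ∞ (volume.restrict A)) :
    piecewiseAffine C →ₗ[ℝ] piecewiseAffine C →ₗ[ℝ] ℝ :=
  (isLinftyLinear_gradient hC A).form ((isLinftyLinear_gradient hC A).smul_left ha)

lemma stiffnessForm_apply (hC : C.Finite) (ha : MemLp a ∞ (volume.restrict A))
    (u v : piecewiseAffine C) :
    stiffnessForm hC ha u v = ∫ x in A, inner ℝ (gradient u.1 x) (gradient v.1 x) * a x := by
  rw [stiffnessForm, IsLinftyLinear.form_apply]
  simp only [real_inner_smul_right, mul_comm]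

lemma integrable_inner_gradient_mul (hC : C.Finite) (ha : MemLp a ∞ (volume.restrict A))
    (u v : piecewiseAffine C) :
    Integrable (fun x => inner ℝ (gradient u.1 x) (gradient v.1 x) * a x)
      (volume.restrict A) := by
  simpa only [real_inner_smul_right, mul_comm] using
    (isLinftyLinear_gradient hC A).integrable_inner
      ((isLinftyLinear_gradient hC A).smul_left ha) u v

/-- The bilinear form `(u, v) ↦ ∫ u ⟪b, ∇v⟫ a` on piecewise affine functions. Only the product
`a b` has to be bounded: the extended velocity is controlled on a band only. -/
noncomputable def advectionForm (hC : C.Finite)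
    (hab : MemLp (fun x => a x • b x) ∞ (volume.restrict A)) :
    piecewiseAffine C →ₗ[ℝ] piecewiseAffine C →ₗ[ℝ] ℝ :=
  (isLinftyLinear_coe hC _).form ((isLinftyLinear_gradient hC A).inner_left hab)

lemma advectionForm_apply (hC : C.Finite)
    (hab : MemLp (fun x => a x • b x) ∞ (volume.restrict A)) (u v : piecewiseAffine C) :
    advectionForm hC hab u v = ∫ x in A, u.1 x * inner ℝ (b x) (gradient v.1 x) * a x := by
  rw [advectionForm, IsLinftyLinear.form_apply]
  exact integral_congr_ae (.of_forall fun x => by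
    simp only [RCLike.inner_apply, Real.ringHom_apply, real_inner_smul_left]; ring)

lemma integrable_mul_inner_gradient_mul (hC : C.Finite)
    (hab : MemLp (fun x => a x • b x) ∞ (volume.restrict A)) (u v : piecewiseAffine C) :
    Integrable (fun x => u.1 x * inner ℝ (b x) (gradient v.1 x) * a x) (volume.restrict A) :=
  ((isLinftyLinear_coe hC _).integrable_inner
    ((isLinftyLinear_gradient hC A).inner_left hab) u v).congr
      (.of_forall fun x => by
        simp only [RCLike.inner_apply, Real.ringHom_apply, real_inner_smul_left]; ring)

end piecewiseAffine

namespace MovingSurface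

open scoped ENNReal

variable {n : ℕ} (S : MovingSurface n) (K : Geometry.SimplicialComplex ℝ (Amb n))

/-- The bilinear form of one step of the scheme at time `t`, with step size `τ`: the part of
`StepEq` that depends on the unknown function. -/
noncomputable def stepForm (δ ε γ τ t : ℝ) (u v : Amb n → ℝ) : ℝ :=
  (∫ x in S.Ω, u x * v x * S.weight ε x t)
    + τ * (∫ x in S.Ω, inner ℝ (gradient u x) (gradient v x) * S.weight ε x t)
    - τ * (∫ x in S.Ω, u x * inner ℝ (S.velExt δ x t) (gradient v x) * S.weight ε x t)
    + γ * τ ^ 2 * (∫ x in S.Ω, inner ℝ (gradient u x) (gradient v x) *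
        S.interp K ε t (fun y => S.phase (2 * ε) y t) x)

/-- The linear functional of one step of the scheme, from time `t'` to time `t`: the part of
`StepEq` that depends on the data `f` and on the previous function `w`. -/
noncomputable def stepData (δ ε : ℝ) (f : Amb n → ℝ → ℝ) (t' t : ℝ) (w v : Amb n → ℝ) : ℝ :=
  (∫ x in S.Ω, w x * v x * S.weight ε x t')
    + (t - t') * (∫ x in S.Ω, S.ext δ f x t * v x * S.weight ε x t)

variable {S K} {δ ε γ τ t t' C : ℝ}

lemma stepEq_iff {f : Amb n → ℝ → ℝ} {w u : Amb n → ℝ} :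
    S.StepEq K δ ε γ f t' t w u ↔ ∀ v ∈ S.feSpace K ε t,
      S.stepForm K δ ε γ (t - t') t u v = S.stepData δ ε f t' t w v := by
  refine forall₂_congr fun v _ => ?_
  simp only [stepForm, stepData, mul_comm (S.interp K ε t _ _)]
  constructor <;> intro h <;> linarith

lemma memLp_top_interp (hK : IsTriangulation S.Ω K) (ε t : ℝ) (f : Amb n → ℝ) :
    MemLp (S.interp K ε t f) ∞ (volume.restrict S.Ω) :=
  (piecewiseAffine.isLinftyLinear_coe (S.finite_activeCells hK) _).memLp
    ⟨_, (S.interp_spec hK ε t f).1⟩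

lemma exists_linearMap_stepData (hK : IsTriangulation S.Ω K) (ht' : t' ∈ Icc 0 S.T)
    (ht : t ∈ Icc 0 S.T) (hε : 0 < ε) (hεδ : ε * Real.pi / 2 ≤ S.δ₀) {f : Amb n → ℝ → ℝ}
    (hf : IntegrableOn (fun x => S.ext δ f x t) (S.band δ t)) {w : Amb n → ℝ}
    (hw : w ∈ S.feSpace K ε t') :
    ∃ ℓ : piecewiseAffine (S.activeCells K ε t) →ₗ[ℝ] ℝ,
      ∀ v, ℓ v = S.stepData δ ε f t' t w v := by
  have := S.isFiniteMeasure_restrict_Ω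
  have hval := piecewiseAffine.isLinftyLinear_coe (S.finite_activeCells (ε := ε) (t := t) hK)
    (volume.restrict S.Ω)
  have hprev : Integrable (fun x => w x * S.weight ε x t') (volume.restrict S.Ω) :=
    ((((piecewiseAffine.isLinftyLinear_coe (S.finite_activeCells hK) _).memLp
      ⟨w, hw⟩).integrable le_top).mul_of_top_left (S.memLp_top_weight ht' hε hεδ))
  have hdata : Integrable (fun x => S.ext δ f x t * S.weight ε x t) (volume.restrict S.Ω) :=
    (S.integrable_ext hf).restrict.mul_of_top_left (S.memLp_top_weight ht hε hεδ)
  refine ⟨hval.functional hprev + (t - t') • hval.functional hdata, fun v => ?_⟩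
  simp only [LinearMap.add_apply, LinearMap.smul_apply, smul_eq_mul, stepData,
    IsLinftyLinear.functional, LinearMap.coe_mk, AddHom.coe_mk, mul_right_comm _ (v.1 _)]

section StepForm

variable (hK : IsTriangulation S.Ω K) (ht : t ∈ Ioc 0 S.T) (hδ : δ < S.δ₀) (hε : 0 < ε)
  (hεδ : ε * Real.pi / 2 ≤ δ)
include ht hδ hε hεδ

lemma memLp_top_weight_smul_velExt :
    MemLp (fun x => S.weight ε x t • S.velExt δ x t) ∞ (volume.restrict S.Ω) := by
  obtain ⟨C, hC⟩ := S.exists_bound_velExt hδ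
  exact S.memLp_top_weight_smul (Ioc_subset_Icc_self ht) hε hεδ hδ.le (S.continuousOn_velExt ht hδ)
    (hC t ht)

include hK

lemma exists_linearMap_stepForm (γ τ : ℝ) :
    ∃ B : piecewiseAffine (S.activeCells K ε t) →ₗ[ℝ]
        piecewiseAffine (S.activeCells K ε t) →ₗ[ℝ] ℝ,
      ∀ u v, B u v = S.stepForm K δ ε γ τ t u v := by
  have := S.isFiniteMeasure_restrict_Ω
  have hcells := S.finite_activeCells (ε := ε) (t := t) hK
  have hweight := S.memLp_top_weight (Ioc_subset_Icc_self ht) hε (hεδ.trans hδ.le)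
  refine ⟨piecewiseAffine.massForm hcells hweight
    + τ • piecewiseAffine.stiffnessForm hcells hweight
    - τ • piecewiseAffine.advectionForm hcells (memLp_top_weight_smul_velExt ht hδ hε hεδ)
    + (γ * τ ^ 2) • piecewiseAffine.stiffnessForm hcells
      (memLp_top_interp hK ε t fun y => S.phase (2 * ε) y t), fun u v => ?_⟩
  simp only [LinearMap.add_apply, LinearMap.sub_apply, LinearMap.smul_apply, smul_eq_mul,
    piecewiseAffine.massForm_apply, piecewiseAffine.stiffnessForm_apply,
    piecewiseAffine.advectionForm_apply, stepForm]

lemma le_stepForm_self (hC : ∀ x ∈ S.band δ t, ‖S.velExt δ x t‖ ≤ C) (hτ : 0 ≤ τ) (γ : ℝ)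
    {u : Amb n → ℝ} (hu : u ∈ piecewiseAffine (S.activeCells K ε t)) :
    (1 - τ * C ^ 2 / 4) * (∫ x in S.Ω, u x ^ 2 * S.weight ε x t)
      + γ * τ ^ 2 * (∫ x in S.Ω, ‖gradient u x‖ ^ 2 *
          S.interp K ε t (fun y => S.phase (2 * ε) y t) x)
      ≤ S.stepForm K δ ε γ τ t u u := by
  have := S.isFiniteMeasure_restrict_Ω
  have hcells := S.finite_activeCells (ε := ε) (t := t) hK
  have hweight := S.memLp_top_weight (Ioc_subset_Icc_self ht) hε (hεδ.trans hδ.le)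
  have hvel : ∀ x, S.weight ε x t ≠ 0 → ‖S.velExt δ x t‖ ≤ C := fun x hx =>
    hC x (S.band_mono hεδ t (not_imp_comm.1 (S.weight_eq_zero hε) hx))
  have hmass := piecewiseAffine.integrable_mul_mul hcells hweight ⟨u, hu⟩ ⟨u, hu⟩
  have hstiffness := piecewiseAffine.integrable_inner_gradient_mul hcells hweight ⟨u, hu⟩ ⟨u, hu⟩
  simp only [← sq, real_inner_self_eq_norm_sq] at hmass hstiffness
  have hyoung := integral_mul_inner_mul_le (fun x => S.weight_nonneg ε x t) hvel hmass hstiffness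
    (piecewiseAffine.integrable_mul_inner_gradient_mul hcells
      (memLp_top_weight_smul_velExt ht hδ hε hεδ) ⟨u, hu⟩ ⟨u, hu⟩)
  simp only [stepForm, ← sq, real_inner_self_eq_norm_sq]
  linarith [mul_le_mul_of_nonneg_left hyoung hτ]

lemma eq_zero_of_stepForm_self_eq_zero (hdesc : S.HasVertexDescent K (ε * Real.pi) t)
    (hC : ∀ x ∈ S.band δ t, ‖S.velExt δ x t‖ ≤ C) (hτ : 0 < τ) (hτC : τ * C ^ 2 < 4) (hγ : 0 < γ)
    {u : Amb n → ℝ} (hu : u ∈ piecewiseAffine (S.activeCells K ε t))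
    (hu₀ : S.stepForm K δ ε γ τ t u u = 0) : u = 0 := by
  have := S.isFiniteMeasure_restrict_Ω
  have hcells := S.finite_activeCells (ε := ε) (t := t) hK
  have hεδ₀ := hεδ.trans hδ.le
  have hcoercive := le_stepForm_self hK ht hδ hε hεδ hC hτ.le γ hu
  have hmass := piecewiseAffine.integrable_mul_mul hcells
    (S.memLp_top_weight (Ioc_subset_Icc_self ht) hε hεδ₀) ⟨u, hu⟩ ⟨u, hu⟩
  have hstab := piecewiseAffine.integrable_inner_gradient_mul hcells
    (memLp_top_interp hK ε t fun y => S.phase (2 * ε) y t) ⟨u, hu⟩ ⟨u, hu⟩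
  simp only [← sq, real_inner_self_eq_norm_sq] at hmass hstab
  have hmass₀ (x : Amb n) : 0 ≤ u x ^ 2 * S.weight ε x t :=
    mul_nonneg (sq_nonneg _) (S.weight_nonneg ε x t)
  have hstab₀ (x : Amb n) :
      0 ≤ ‖gradient u x‖ ^ 2 * S.interp K ε t (fun y => S.phase (2 * ε) y t) x :=
    mul_nonneg (sq_nonneg _) (S.interp_phase_nonneg hK x)
  have hκ : 0 < 1 - τ * C ^ 2 / 4 := by linarith
  have hγτ : 0 < γ * τ ^ 2 := by positivity
  have hmassTerm := mul_nonneg hκ.le (integral_nonneg (μ := volume.restrict S.Ω) hmass₀)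
  have hstabTerm := mul_nonneg hγτ.le (integral_nonneg (μ := volume.restrict S.Ω) hstab₀)
  have hval := (integral_eq_zero_iff_of_nonneg hmass₀ hmass).1
    ((mul_eq_zero.1 (by linarith)).resolve_left hκ.ne')
  have hgrad := (integral_eq_zero_iff_of_nonneg hstab₀ hstab).1
    ((mul_eq_zero.1 (by linarith)).resolve_left hγτ.ne')
  exact eq_zero_of_hasVertexDescent hK (Ioc_subset_Icc_self ht) hε hεδ₀ hdesc hu hval
    (hgrad.mono fun x hx => (mul_comm _ _).trans hx)

theorem existsUnique_stepEq (hdesc : S.HasVertexDescent K (ε * Real.pi) t)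
    (hC : ∀ x ∈ S.band δ t, ‖S.velExt δ x t‖ ≤ C) (ht' : t' ∈ Icc 0 S.T) (htt' : t' < t)
    (hτC : (t - t') * C ^ 2 < 4) (hγ : 0 < γ) {f : Amb n → ℝ → ℝ}
    (hf : IntegrableOn (fun x => S.ext δ f x t) (S.band δ t)) {w : Amb n → ℝ}
    (hw : w ∈ S.feSpace K ε t') :
    ∃! u : Amb n → ℝ, u ∈ S.feSpace K ε t ∧ S.StepEq K δ ε γ f t' t w u := by
  have := piecewiseAffine.finiteDimensional (S.finite_activeCells (ε := ε) (t := t) hK)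
  obtain ⟨B, hB⟩ := exists_linearMap_stepForm hK ht hδ hε hεδ γ (t - t')
  obtain ⟨ℓ, hℓ⟩ := exists_linearMap_stepData hK ht' (Ioc_subset_Icc_self ht) hε
    (hεδ.trans hδ.le) hf hw
  have hdef : ∀ u, B u u = 0 → u = 0 := fun u hu =>
    Subtype.ext (eq_zero_of_stepForm_self_eq_zero hK ht hδ hε hεδ hdesc hC (sub_pos.2 htt') hτC hγ
      u.2 (hB u u ▸ hu))
  have hsolve := existsUnique_of_definite B hdef ℓ
  simp only [hB, hℓ, Subtype.forall] at hsolve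
  simp only [stepEq_iff]
  exact existsUnique_of_subtype (V := S.feSpace K ε t) hsolve

end StepForm

theorem existsUnique_initEq (hK : IsTriangulation S.Ω K) {u₀ : Amb n → ℝ}
    (hu₀ : IntegrableOn (fun x => S.ext δ (fun y _ => u₀ y) x 0) (S.band δ 0)) :
    ∃! u : Amb n → ℝ, u ∈ S.feSpace K ε 0 ∧ S.InitEq K δ ε u₀ u := by
  have hcells := S.finite_activeCells (ε := ε) (t := 0) hK
  have := piecewiseAffine.finiteDimensional hcells
  set D := S.discreteBand K ε 0
  have : IsFiniteMeasure (volume.restrict D) :=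
    isFiniteMeasure_restrict.2 (isCompact_region hcells).measure_ne_top
  have hval := piecewiseAffine.isLinftyLinear_coe hcells (volume.restrict D)
  have hdef : ∀ u, hval.form hval u u = 0 → u = 0 := fun u hu => by
    rw [hval.form_apply] at hu
    have hae := (integral_eq_zero_iff_of_nonneg (fun x => real_inner_self_nonneg)
      (hval.integrable_inner hval u u)).1 hu
    refine Subtype.ext (piecewiseAffine.ext_vertices u.2 (Submodule.zero_mem _) fun s hs x hx => ?_)
    have hsub : simplex s ⊆ D := simplex_subset_region hs
    have hae₀ : u.1 =ᵐ[volume.restrict (simplex s)] 0 :=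
      (ae_restrict_of_ae_restrict_of_subset hsub hae).mono fun x hx => inner_self_eq_zero.1 hx
    exact Measure.eqOn_of_ae_eq hae₀ (u.2.1.mono hsub) continuousOn_const
      (simplex_subset_closure_interior hs.1) (mem_simplex_of_mem hx)
  have hsolve := existsUnique_of_definite (hval.form hval) hdef
    (hval.functional (S.integrable_ext hu₀).restrict)
  simp only [IsLinftyLinear.form_apply, IsLinftyLinear.functional, LinearMap.coe_mk,
    AddHom.coe_mk, Subtype.forall, Real.inner_apply] at hsolve
  exact existsUnique_of_subtype (V := S.feSpace K ε 0) hsolve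

end MovingSurface

namespace TimePartition

variable {T : ℝ} (P : TimePartition T)

lemma mem_Icc (m : Fin (P.M + 1)) : P.t m ∈ Icc 0 T :=
  ⟨P.first.symm.trans_le (P.strictMono.monotone (Fin.zero_le m)),
    (P.strictMono.monotone (Fin.le_last m)).trans_eq P.last⟩

lemma castSucc_lt_succ (m : Fin P.M) : P.t m.castSucc < P.t m.succ :=
  P.strictMono Fin.castSucc_lt_succ

lemma succ_mem_Ioc (m : Fin P.M) : P.t m.succ ∈ Ioc 0 T :=
  ⟨(P.mem_Icc m.castSucc).1.trans_lt (P.castSucc_lt_succ m), (P.mem_Icc m.succ).2⟩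

lemma sub_le_maxStep (m : Fin P.M) : P.t m.succ - P.t m.castSucc ≤ P.maxStep :=
  le_ciSup (f := fun m : Fin P.M => P.t m.succ - P.t m.castSucc) (finite_range _).bddAbove m

end TimePartition

theorem lemma5_general {n : ℕ} (S : MovingSurface n) {δ σ : ℝ} (hδ₀ : δ < S.δ₀) (hσ : 0 < σ) :
    ∃ h₁ τ₀ : ℝ, 0 < h₁ ∧ 0 < τ₀ ∧
      ∀ K : Geometry.SimplicialComplex ℝ (Amb n),
        IsTriangulation S.Ω K → meshSize K ≤ h₁ → IsShapeRegular σ K →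
      ∀ ε : ℝ, 0 < ε → ε < δ / Real.pi → ∀ γ : ℝ, 0 < γ →
      ∀ P : TimePartition S.T, P.maxStep ≤ τ₀ →
      ∀ f : Amb n → ℝ → ℝ,
        (∀ m : Fin P.M, IntegrableOn (fun x => S.ext δ f x (P.t m.succ))
          (S.band δ (P.t m.succ))) →
        (∀ m : Fin P.M, ∀ w ∈ S.feSpace K ε (P.t m.castSucc),
          ∃! u : Amb n → ℝ, u ∈ S.feSpace K ε (P.t m.succ) ∧
            S.StepEq K δ ε γ f (P.t m.castSucc) (P.t m.succ) w u) ∧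
        ∀ u₀ : Amb n → ℝ,
          IntegrableOn (fun x => S.ext δ (fun y _ => u₀ y) x 0) (S.band δ 0) →
          ∃! u : Fin (P.M + 1) → Amb n → ℝ, S.IsDiscreteSolution K δ ε γ P u₀ f u := by
  obtain ⟨C, hC⟩ := S.exists_bound_velExt hδ₀
  obtain ⟨h₁, hh₁, hmesh⟩ := MovingSurface.exists_meshSize_bound S hδ₀ hσ
  refine ⟨h₁, 1 / (C ^ 2 + 1), hh₁, by positivity, fun K hK hKh hreg ε hε hεδ γ hγ P hP f hf => ?_⟩
  obtain ⟨hKδ, hKσ⟩ := hmesh _ hKh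
  have hεδ : ε * Real.pi < δ := (lt_div_iff₀ Real.pi_pos).1 hεδ
  have hε_half : ε * Real.pi / 2 ≤ δ := by linarith [mul_pos hε Real.pi_pos]
  have hstep_small : ∀ m : Fin P.M, (P.t m.succ - P.t m.castSucc) * C ^ 2 < 4 := fun m => by
    have hle := (P.sub_le_maxStep m).trans hP
    rw [le_div_iff₀ (by positivity)] at hle
    linarith [P.castSucc_lt_succ m]
  have hstep : ∀ m : Fin P.M, ∀ w ∈ S.feSpace K ε (P.t m.castSucc),
      ∃! u : Amb n → ℝ, u ∈ S.feSpace K ε (P.t m.succ) ∧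
        S.StepEq K δ ε γ f (P.t m.castSucc) (P.t m.succ) w u := fun m w hw =>
    MovingSurface.existsUnique_stepEq hK (P.succ_mem_Ioc m) hδ₀ hε hε_half
      (MovingSurface.hasVertexDescent hK hσ hreg (P.mem_Icc _) (by linarith) hKσ)
      (hC _ (P.succ_mem_Ioc m)) (P.mem_Icc _) (P.castSucc_lt_succ m) (hstep_small m) hγ (hf m) hw
  exact ⟨hstep, fun u₀ hu₀ => existsUnique_fin_recursion (V := fun m => S.feSpace K ε (P.t m))
    (P.first ▸ MovingSurface.existsUnique_initEq hK hu₀) hstep⟩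

theorem lemma5 {n : ℕ} (hn : n = 1 ∨ n = 2) (S : MovingSurface n)
    (δ : ℝ) (hδ : 0 < δ) (hδ₀ : δ < S.δ₀) (h₀ σ : ℝ) (hh₀ : 0 < h₀) (hσ : 0 < σ) :
    ∃ h₁ : ℝ, 0 < h₁ ∧ h₁ ≤ h₀ ∧ ∀ h : ℝ, 0 < h → h ≤ h₁ →
      ∃ τ₀ : ℝ, 0 < τ₀ ∧
        ∀ K : Geometry.SimplicialComplex ℝ (Amb n),
          IsTriangulation S.Ω K → meshSize K = h → IsShapeRegular σ K →
        ∀ ε : ℝ, 0 < ε → ε < δ / Real.pi → ∀ γ : ℝ, 0 < γ →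
        ∀ P : TimePartition S.T, P.maxStep ≤ τ₀ →
        ∀ f : Amb n → ℝ → ℝ,
          (∀ m : Fin P.M, IntegrableOn (fun x => S.ext δ f x (P.t m.succ))
            (S.band δ (P.t m.succ))) →
          (∀ m : Fin P.M, ∀ w ∈ S.feSpace K ε (P.t m.castSucc),
            ∃! u : Amb n → ℝ, u ∈ S.feSpace K ε (P.t m.succ) ∧
              S.StepEq K δ ε γ f (P.t m.castSucc) (P.t m.succ) w u) ∧
          ∀ u₀ : Amb n → ℝ,
            IntegrableOn (fun x => S.ext δ (fun y _ => u₀ y) x 0) (S.band δ 0) →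
            ∃! u : Fin (P.M + 1) → Amb n → ℝ, S.IsDiscreteSolution K δ ε γ P u₀ f u := by
  obtain ⟨h₁, τ₀, hh₁, hτ₀, hsolvable⟩ := lemma5_general S hδ₀ hσ
  exact ⟨min h₀ h₁, lt_min hh₀ hh₁, min_le_left _ _, fun h _ hle => ⟨τ₀, hτ₀, fun K hK hmesh =>
    hsolvable K hK (hmesh.trans_le (hle.trans (min_le_right _ _)))⟩⟩
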